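/- Let $k$ be a perfect field of characteristic $p>0$, let $G$ be a connected split reductive group over $k$, and fix an isomorphism of $k$-groups $\varphi\colon F_k^*G\cong G$, where $F_k$ is the Frobenius of $\operatorname{Spec}k$ (such $\varphi$ exist because $G$ is split). Let $Z$ be a smooth projective variety over $k$ with an ample line bundle $H$, let $Z'=Z\times_{k,F_k}k$, and let $\pi=\pi_{Z/k}\colon Z'\to Z$ be the projection. By means of $\varphi$, the pullback along $\pi$ of a principal $G$-bundle on $Z$ is a principal $G$-bundle on $Z'$. A $G$-Higgs bundle $(V,\theta)$ is a principal $G$-bundle $V$ with $\theta\in H^0(Z,V(\mathfrak g)\otimes\Omega_{Z/k})$ and $\theta\wedge\theta=0$. An integrable $G$-connection $(E,\nabla)$ is a principal $G$-bundle $E$ with a section $T_{Z/k}\to\mathrm{At}(E)$ of Lie algebroids. Such a pair is called $R$-stable with respect to $H$ if for every proper parabolic subgroup $P\subset G$, every reduction $Q$ of the bundle to $P$ compatible with $\theta$ (resp. $\nabla$), and every non-trivial antidominant character $\chi\colon P\to\mathbb G_m$ which is trivial on the center of $P$, one has $\deg_H\chi_*Q>0$. It is called rigid if there do not exist a geometrically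 irreducible $k$-scheme $C$ of finite type and of positive dimension, a family of $G$-Higgs bundles (resp. integrable $G$-connections) on $Z\times_kC$ relative to $C$, a finite extension $k'/k$ and points $c_0,c_1\in C(k')$, such that the fibre at $c_0$ is isomorphic to the base change to $k'$ of the given pair, and the fibres at $c_0$ and $c_1$ are not isomorphic over $\bar k$. The same definitions are used on $Z'$, with $\pi^*H$ in place of $H$. Let $(V,\theta)$ be a $G$-Higgs bundle on $Z$ which is $R$-stable with respect to $H$. Then its pullback $\pi^*(V,\theta)$ exists, is unique and is $R$-stable with respect to $\pi^*H$, and $(V,\theta)$ is rigid if and only if $\pi^*(V,\theta)$ is rigid. The same holds for every integrable $G$-connection $(E,\nabla)$ on $Z$ which is $R$-stable with respect to $H$. (No lower bound on $p$ is needed; in particular the statement holds for all large $p$.) -/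

import Mathlib

open CategoryTheory Limits MonoidalCategory CartesianMonoidalCategory AlgebraicGeometry MonObj
open scoped CategoryTheory.Obj

universe u

noncomputable section

namespace HiggsRig

/-! ## Relative vector fields -/

/-- A section over the open `U ⊆ Y` of the relative tangent sheaf `T_{Y/S}` of `f : Y ⟶ S`:
a compatible family of derivations of `Γ(Y, W)`, for `W ⊆ U` open, which kill the functions
coming from `S`. -/
structure RelVectorField {Y S : Scheme.{u}} (f : Y ⟶ S) (U : Y.Opens) where
  der : ∀ W : Y.Opens, W ≤ U → Derivation ℤ Γ(Y, W) Γ(Y, W)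
  der_res : ∀ (W W' : Y.Opens) (hW : W ≤ U) (i : W' ≤ W) (x : Γ(Y, W)),
    der W' (i.trans hW) (Y.presheaf.map (homOfLE i).op x) =
      Y.presheaf.map (homOfLE i).op (der W hW x)
  der_base : ∀ (R : S.Opens) (W : Y.Opens) (hW : W ≤ U) (e : W ≤ f ⁻¹ᵁ R) (s : Γ(S, R)),
    der W hW (f.appLE R W e s) = 0

namespace RelVectorField

variable {Y S : Scheme.{u}} {f : Y ⟶ S} {U : Y.Opens}

instance : Add (RelVectorField f U) where
  add D₁ D₂ :=
    { der := fun W hW => D₁.der W hW + D₂.der W hW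
      der_res := by
        intro W W' hW i x
        exact (congrArg₂ (· + ·) (D₁.der_res W W' hW i x) (D₂.der_res W W' hW i x)).trans
          (map_add (Y.presheaf.map (homOfLE i).op).hom _ _).symm
      der_base := by
        intro R W hW e s
        simp [D₁.der_base, D₂.der_base] }

instance : SMul Γ(Y, U) (RelVectorField f U) where
  smul a D :=
    { der := fun W hW => Y.presheaf.map (homOfLE hW).op a • D.der W hW
      der_res := by
        intro W W' hW i x
        have h : Y.presheaf.map (homOfLE (i.trans hW)).op a =
            Y.presheaf.map (homOfLE i).op (Y.presheaf.map (homOfLE hW).op a) := by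
          rw [← CommRingCat.comp_apply, ← Functor.map_comp]
          rfl
        exact (congrArg₂ (· * ·) h (D.der_res W W' hW i x)).trans
          (map_mul (Y.presheaf.map (homOfLE i).op).hom _ _).symm
      der_base := by
        intro R W hW e s
        simp [D.der_base] }

/-- The Lie bracket of vector fields. -/
instance : Bracket (RelVectorField f U) (RelVectorField f U) where
  bracket D₁ D₂ :=
    { der := fun W hW => ⁅D₁.der W hW, D₂.der W hW⁆
      der_res := by
        intro W W' hW i x
        have h₁ := (congrArg (D₁.der W' (i.trans hW)) (D₂.der_res W W' hW i x)).trans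
          (D₁.der_res W W' hW i _)
        have h₂ := (congrArg (D₂.der W' (i.trans hW)) (D₁.der_res W W' hW i x)).trans
          (D₂.der_res W W' hW i _)
        rw [Derivation.commutator_apply, Derivation.commutator_apply]
        exact (congrArg₂ (· - ·) h₁ h₂).trans
          (map_sub (Y.presheaf.map (homOfLE i).op).hom _ _).symm
      der_base := by
        intro R W hW e s
        simp [Derivation.commutator_apply, D₁.der_base, D₂.der_base] }

/-- Restriction of vector fields to a smaller open set. -/
def restrict (D : RelVectorField f U) {U' : Y.Opens} (i : U' ≤ U) : RelVectorField f U' where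
  der W hW := D.der W (hW.trans i)
  der_res W W' hW j x := D.der_res W W' (hW.trans i) j x
  der_base R W hW e s := D.der_base R W (hW.trans i) e s

end RelVectorField

/-- `D'` (on an open of `Y'`) and `D` (on an open of `Y`) are `h`-related:
`D' (h^♯ x) = h^♯ (D x)` for all local functions `x` on `Y`. -/
def Related {Y' S' Y S : Scheme.{u}} {f' : Y' ⟶ S'} {f : Y ⟶ S} (h : Y' ⟶ Y)
    {U' : Y'.Opens} {U : Y.Opens} (D' : RelVectorField f' U') (D : RelVectorField f U) : Prop :=
  ∀ (W : Y.Opens) (hW : W ≤ U) (W' : Y'.Opens) (hW' : W' ≤ U') (e : W' ≤ h ⁻¹ᵁ W) (x : Γ(Y, W)),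
    D'.der W' hW' (h.appLE W W' e x) = h.appLE W W' e (D.der W hW x)

/-! ## Principal bundles -/

/-- A principal (right) `G`-bundle on `Y`: an fppf `G`-torsor `tot ⟶ Y`, with `G` a group scheme
over `B` and `Y` a scheme over `B`. For smooth `G` this is the same as an étale `G`-torsor. -/
structure GBundle {B : Scheme.{u}} (G : Over B) [GrpObj G] (Y : Over B) where
  tot : Over B
  proj : tot ⟶ Y
  act : tot ⊗ G ⟶ tot
  act_one : tot ◁ η[G] ≫ act = (ρ_ tot).hom
  act_mul : act ▷ G ≫ act = (α_ tot G G).hom ≫ tot ◁ μ[G] ≫ act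
  flat : Flat proj.left
  surjective : Surjective proj.left
  locallyOfFinitePresentation : LocallyOfFinitePresentation proj.left
  /-- `(v, g) ↦ (v, v g)` is an isomorphism from `tot ×_B G` to `tot ×_Y tot`. -/
  torsor : IsPullback (fst tot G) act proj proj

/-- A line bundle on `Y`, given as a principal (right) `𝔾ₘ`-bundle. The action of `𝔾ₘ` is given on
`T`-valued points, where `𝔾ₘ(T) = Γ(T, ⊤)ˣ`. -/
structure LineBundle (Y : Scheme.{u}) where
  tot : Scheme.{u}
  proj : tot ⟶ Y
  act : ∀ {T : Scheme.{u}}, (T ⟶ tot) → Γ(T, ⊤)ˣ → (T ⟶ tot)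
  act_comp : ∀ {T T' : Scheme.{u}} (h : T' ⟶ T) (v : T ⟶ tot) (s : Γ(T, ⊤)ˣ),
    h ≫ act v s = act (h ≫ v) (Units.map h.appTop.hom s)
  act_one : ∀ {T : Scheme.{u}} (v : T ⟶ tot), act v 1 = v
  act_mul : ∀ {T : Scheme.{u}} (v : T ⟶ tot) (s t : Γ(T, ⊤)ˣ), act (act v s) t = act v (s * t)
  act_proj : ∀ {T : Scheme.{u}} (v : T ⟶ tot) (s : Γ(T, ⊤)ˣ), act v s ≫ proj = v ≫ proj
  flat : Flat proj
  surjective : Surjective proj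
  locallyOfFinitePresentation : LocallyOfFinitePresentation proj
  torsor : ∀ {T : Scheme.{u}} (v w : T ⟶ tot), v ≫ proj = w ≫ proj →
    ∃! s : Γ(T, ⊤)ˣ, w = act v s

/-- The pullback of a line bundle. -/
def LineBundle.pullback {Y Y' : Scheme.{u}} (L : LineBundle Y) (h : Y' ⟶ Y) : LineBundle Y' where
  tot := Limits.pullback L.proj h
  proj := pullback.snd L.proj h
  act v s := pullback.lift (L.act (v ≫ pullback.fst _ _) s) (v ≫ pullback.snd _ _) (by
    rw [L.act_proj, Category.assoc, pullback.condition, Category.assoc])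
  act_comp k v s := by
    apply pullback.hom_ext
    · rw [Category.assoc, pullback.lift_fst, L.act_comp, ← Category.assoc, pullback.lift_fst]
    · rw [Category.assoc, pullback.lift_snd, ← Category.assoc, pullback.lift_snd]
  act_one v := by
    apply pullback.hom_ext
    · rw [pullback.lift_fst, L.act_one]
    · rw [pullback.lift_snd]
  act_mul v s t := by
    apply pullback.hom_ext
    · rw [pullback.lift_fst, pullback.lift_fst, pullback.lift_fst, L.act_mul]
    · rw [pullback.lift_snd, pullback.lift_snd, pullback.lift_snd]
  act_proj v s := pullback.lift_snd _ _ _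
  flat := by have := L.flat; infer_instance
  surjective := by have := L.surjective; infer_instance
  locallyOfFinitePresentation := by have := L.locallyOfFinitePresentation; infer_instance
  torsor v w hvw := by
    obtain ⟨s, hs, hu⟩ := L.torsor (v ≫ pullback.fst _ _) (w ≫ pullback.fst _ _) (by
      rw [Category.assoc, Category.assoc, pullback.condition, reassoc_of% hvw])
    refine ⟨s, ?_, ?_⟩
    · apply pullback.hom_ext
      · rw [pullback.lift_fst, hs]
      · rw [pullback.lift_snd]
        exact hvw.symm
    · intro t ht
      apply hu
      rw [ht, pullback.lift_fst]

/-- The projection of a base change of a morphism over `B` is itself a base change. -/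
theorem isPullback_map_pullback {B B' : Scheme.{u}} (b : B' ⟶ B) {X Y : Over B} (f : X ⟶ Y) :
    IsPullback (pullback.fst X.hom b) ((Over.pullback b).map f).left f.left
      (pullback.fst Y.hom b) := by
  have h₁ : IsPullback (pullback.fst Y.hom b) (pullback.snd Y.hom b) Y.hom b :=
    IsPullback.of_hasPullback _ _
  have h₂ : IsPullback (pullback.fst X.hom b) (pullback.snd X.hom b) X.hom b :=
    IsPullback.of_hasPullback _ _
  refine IsPullback.of_bot ?_ (pullback.lift_fst _ _ _).symm h₁
  have e₁ : ((Over.pullback b).map f).left ≫ pullback.snd Y.hom b = pullback.snd X.hom b :=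
    pullback.lift_snd _ _ _
  rw [e₁, Over.w]
  exact h₂

/-- Base change of a principal `G`-bundle on `Y` along `b : B' ⟶ B`: a principal bundle under
`B' ×_B G` on `B' ×_B Y`. -/
def GBundle.baseChange {B B' : Scheme.{u}} {G : Over B} [GrpObj G] {Y : Over B} (E : GBundle G Y)
    (b : B' ⟶ B) : GBundle ((Over.pullback b).obj G) ((Over.pullback b).obj Y) where
  tot := (Over.pullback b).obj E.tot
  proj := (Over.pullback b).map E.proj
  act := Functor.LaxMonoidal.μ (Over.pullback b) E.tot G ≫ (Over.pullback b).map E.act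
  act_one := by
    rw [Functor.obj.η_def, MonoidalCategory.whiskerLeft_comp_assoc,
      Functor.LaxMonoidal.μ_natural_right_assoc, ← Functor.map_comp, E.act_one,
      Functor.LaxMonoidal.right_unitality]
  act_mul := by
    rw [Functor.obj.μ_def, MonoidalCategory.whiskerLeft_comp_assoc,
      Functor.LaxMonoidal.μ_natural_right_assoc, ← Functor.map_comp,
      MonoidalCategory.comp_whiskerRight_assoc, Functor.LaxMonoidal.μ_natural_left_assoc,
      ← Functor.map_comp, E.act_mul, Functor.map_comp, Functor.LaxMonoidal.associativity_assoc]
  flat := MorphismProperty.of_isPullback (isPullback_map_pullback b E.proj) E.flat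
  surjective := MorphismProperty.of_isPullback (isPullback_map_pullback b E.proj) E.surjective
  locallyOfFinitePresentation := MorphismProperty.of_isPullback (isPullback_map_pullback b E.proj)
    E.locallyOfFinitePresentation
  torsor := by
    refine IsPullback.of_iso (E.torsor.map (Over.pullback b))
      (Functor.Monoidal.μIso (Over.pullback b) E.tot G).symm (Iso.refl _) (Iso.refl _)
      (Iso.refl _) ?_ ?_ ?_ ?_
    · simp [← Functor.Monoidal.μ_fst]
    · simp
    · simp
    · simp

/-- Transport of a principal bundle along an isomorphism of group schemes. -/
def GBundle.transport {B : Scheme.{u}} {G G' : Over B} [GrpObj G] [GrpObj G'] {Y : Over B}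
    (E : GBundle G Y) (φ : G ≅ G') [IsMonHom φ.hom] : GBundle G' Y where
  tot := E.tot
  proj := E.proj
  act := E.tot ◁ φ.inv ≫ E.act
  act_one := by
    rw [← MonoidalCategory.whiskerLeft_comp_assoc, IsMonHom.one_hom, E.act_one]
  act_mul := by
    rw [← MonoidalCategory.whiskerLeft_comp_assoc, IsMonHom.mul_hom,
      MonoidalCategory.comp_whiskerRight_assoc, ← MonoidalCategory.whisker_exchange_assoc,
      E.act_mul, MonoidalCategory.tensorHom_def]
    simp
  flat := E.flat
  surjective := E.surjective
  locallyOfFinitePresentation := E.locallyOfFinitePresentation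
  torsor := by
    refine IsPullback.of_iso E.torsor (whiskerLeftIso E.tot φ) (Iso.refl _) (Iso.refl _)
      (Iso.refl _) ?_ ?_ ?_ ?_
    · simp
    · simp
    · simp
    · simp

/-! ## Higgs fields and integrable connections -/

/-- A vector field on `E|_U` is `G`-invariant: the vector field `D̃ = D ⊠ 0` on `E ×_B G` is related
to `D` by the action map `(v, g) ↦ v g`. -/
def GBundle.IsInvariant {B : Scheme.{u}} {G : Over B} [GrpObj G] {Y : Over B} (E : GBundle G Y)
    {S : Scheme.{u}} {f : E.tot.left ⟶ S} {U : Y.left.Opens}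
    (D : RelVectorField f (E.proj.left ⁻¹ᵁ U)) : Prop :=
  ∃ D' : RelVectorField (snd E.tot G).left ((fst E.tot G).left ⁻¹ᵁ (E.proj.left ⁻¹ᵁ U)),
    Related (fst E.tot G).left D' D ∧ Related E.act.left D' D

/-- An integrable `c`-connection on the principal `G`-bundle `E` over `Y`, relative to a smooth
`f : Y ⟶ S`. It is an `𝒪_Y`-linear map from `T_{Y/S}` to the Atiyah algebroid
`At(E) = (proj_* T_{E/S})^G` of `G`-invariant vector fields, such that the composite with the anchor
`At(E) ⟶ T_{Y/S}` is multiplication by `c`, and `[D u, D v] = c D [u, v]`.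

* `c = 1`: a section `T_{Y/S} ⟶ At(E)` of Lie algebroids, i.e. an integrable `G`-connection.
* `c = 0`: the invariant vertical vector fields `(proj_* T_{E/Y})^G` are the sections of the adjoint
  bundle `E(𝔤)`, so this is an `𝒪_Y`-linear map `θ : T_{Y/S} ⟶ E(𝔤)`, i.e. a section of
  `E(𝔤) ⊗ Ω_{Y/S}`, such that `[θ u, θ v] = 0`, i.e. `θ ∧ θ = 0`: a Higgs field. -/
structure LambdaConnection (c : ℤ) {B : Scheme.{u}} {G : Over B} [GrpObj G] {Y : Over B}
    (E : GBundle G Y) {S : Scheme.{u}} (f : Y.left ⟶ S) where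
  toFun : ∀ U : Y.left.Opens,
    RelVectorField f U → RelVectorField (E.proj.left ≫ f) (E.proj.left ⁻¹ᵁ U)
  map_add : ∀ (U : Y.left.Opens) (u v : RelVectorField f U), toFun U (u + v) = toFun U u + toFun U v
  map_smul : ∀ (U : Y.left.Opens) (a : Γ(Y.left, U)) (u : RelVectorField f U),
    toFun U (a • u) = E.proj.left.app U a • toFun U u
  map_restrict : ∀ (U U' : Y.left.Opens) (i : U' ≤ U) (u : RelVectorField f U),
    toFun U' (u.restrict i) = (toFun U u).restrict (fun _ hx => i hx)
  invariant : ∀ (U : Y.left.Opens) (u : RelVectorField f U), E.IsInvariant (toFun U u)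
  anchor : ∀ (U : Y.left.Opens) (u : RelVectorField f U) (W : Y.left.Opens) (hW : W ≤ U)
    (x : Γ(Y.left, W)), (toFun U u).der (E.proj.left ⁻¹ᵁ W) (fun _ hx => hW hx)
      (E.proj.left.app W x) = c • E.proj.left.app W (u.der W hW x)
  integrable : ∀ (U : Y.left.Opens) (u v : RelVectorField f U) (W : E.tot.left.Opens)
    (hW : W ≤ E.proj.left ⁻¹ᵁ U) (x : Γ(E.tot.left, W)),
    ⁅toFun U u, toFun U v⁆.der W hW x = c • (toFun U ⁅u, v⁆).der W hW x

/-- Higgs fields on a principal bundle over `Y`, relative to `f : Y ⟶ S`. -/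
abbrev HiggsField {B : Scheme.{u}} {G : Over B} [GrpObj G] {Y : Over B} (E : GBundle G Y)
    {S : Scheme.{u}} (f : Y.left ⟶ S) := LambdaConnection 0 E f

/-- Integrable `G`-connections on a principal bundle over `Y`, relative to `f : Y ⟶ S`. -/
abbrev IntegrableConnection {B : Scheme.{u}} {G : Over B} [GrpObj G] {Y : Over B} (E : GBundle G Y)
    {S : Scheme.{u}} (f : Y.left ⟶ S) := LambdaConnection 1 E f

/-- `D'` is compatible with `D` along `m : E' ⟶ E` lying over `h : Y' ⟶ Y`: whenever the vector
field `u'` on `Y'` lifts the vector field `u` on `Y`, then `D' u'` lifts `D u`. If `m` is cartesian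
over `h` and `f'` is the base change of the smooth `f` along some `S' ⟶ S`, then the vector fields
lifting some `u` generate `T_{Y'/S'} = h^* T_{Y/S}`, and this says that `D'` is the pullback of
`D`. -/
def PullsBackAlong {c : ℤ} {B B' : Scheme.{u}} {G : Over B} [GrpObj G] {G' : Over B'} [GrpObj G']
    {Y : Over B} {Y' : Over B'} {E : GBundle G Y} {E' : GBundle G' Y'} {S S' : Scheme.{u}}
    {f : Y.left ⟶ S} {f' : Y'.left ⟶ S'} (D' : LambdaConnection c E' f')
    (D : LambdaConnection c E f) (m : E'.tot.left ⟶ E.tot.left) (h : Y'.left ⟶ Y.left) : Prop :=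
  ∀ (U : Y.left.Opens) (u : RelVectorField f U) (u' : RelVectorField f' (h ⁻¹ᵁ U)),
    Related h u' u → Related m (D'.toFun (h ⁻¹ᵁ U) u') (D.toFun U u)

/-- `(E', D')` on `Y'/S'` is a pullback of `(E, D)` on `Y/S` along `h : Y' ⟶ Y`. -/
def IsPullbackOf {c : ℤ} {B : Scheme.{u}} {G : Over B} [GrpObj G] {Y Y' : Over B}
    {E : GBundle G Y} {E' : GBundle G Y'} {S S' : Scheme.{u}}
    {f : Y.left ⟶ S} {f' : Y'.left ⟶ S'} (D' : LambdaConnection c E' f')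
    (D : LambdaConnection c E f) (h : Y' ⟶ Y) : Prop :=
  ∃ m : E'.tot ⟶ E.tot, IsPullback m E'.proj E.proj h ∧ E'.act ≫ m = m ▷ G ≫ E.act ∧
    PullsBackAlong D' D m.left h.left

/-- The pullbacks of `(E₁, D₁)` along `h₁ : Y' ⟶ Y₁` and of `(E₂, D₂)` along `h₂ : Y' ⟶ Y₂` are
isomorphic on `Y'/S'`. (Pullbacks are unique up to isomorphism, so this says that some object is a
pullback of both.) -/
def IsoPullbacks {c : ℤ} {B : Scheme.{u}} {G : Over B} [GrpObj G] {Y₁ Y₂ Y' : Over B}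
    {E₁ : GBundle G Y₁} {E₂ : GBundle G Y₂} {S₁ S₂ S' : Scheme.{u}}
    {f₁ : Y₁.left ⟶ S₁} {f₂ : Y₂.left ⟶ S₂} (D₁ : LambdaConnection c E₁ f₁)
    (D₂ : LambdaConnection c E₂ f₂) (f' : Y'.left ⟶ S') (h₁ : Y' ⟶ Y₁) (h₂ : Y' ⟶ Y₂) : Prop :=
  ∃ (E' : GBundle G Y') (D' : LambdaConnection c E' f'), IsPullbackOf D' D₁ h₁ ∧ IsPullbackOf D' D₂ h₂

/-! ## Rigidity -/

section Field

variable {k : Type u} [Field k]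

/-- `Spec k'` as a scheme over `Spec k`, for an extension `k'` of `k`. -/
abbrev pt (k k' : Type u) [Field k] [Field k'] [Algebra k k'] : Over (Spec (.of k)) :=
  Over.mk (Spec.map (CommRingCat.ofHom (algebraMap k k')))

/-- The map `Spec k̄ ⟶ Spec k'` over `Spec k`, for `k ⊆ k' ⊆ k̄`. -/
def geomPt (k' : IntermediateField k (AlgebraicClosure k)) :
    pt k (AlgebraicClosure k) ⟶ pt k k' :=
  Over.homMk (Spec.map (CommRingCat.ofHom (algebraMap k' (AlgebraicClosure k)))) (by
    simp only [Over.mk_left, Over.mk_hom, ← Spec.map_comp, ← CommRingCat.ofHom_comp]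
    rw [← IsScalarTower.algebraMap_eq])

/-- Deformation-theoretic rigidity. `(E, D)` on `Z` is *not* rigid iff there are a geometrically
irreducible `k`-scheme `C` of finite type and of positive dimension, a `C`-family `(E_C, D_C)`, a
finite extension `k'` of `k`, and `c₀, c₁ ∈ C(k')`, such that the fibre at `c₀` is isomorphic to
`(E, D)_{k'}` and the fibres at `c₀` and `c₁` are not isomorphic over `k̄`. -/
def IsRigid {c : ℤ} {G : Over (Spec (.of k))} [GrpObj G] {Z : Over (Spec (.of k))}
    {E : GBundle G Z} (D : LambdaConnection c E Z.hom) : Prop :=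
  ¬ ∃ (C : Over (Spec (.of k))) (EC : GBundle G (Z ⊗ C)) (DC : LambdaConnection c EC (snd Z C).left)
    (k' : IntermediateField k (AlgebraicClosure k)) (c₀ c₁ : pt k k' ⟶ C),
    LocallyOfFiniteType C.hom ∧ QuasiCompact C.hom ∧ GeometricallyIrreducible C.hom ∧
    0 < topologicalKrullDim C.left ∧ FiniteDimensional k k' ∧
    IsoPullbacks DC D (snd Z (pt k k')).left (Z ◁ c₀) (fst Z (pt k k')) ∧
    ¬ IsoPullbacks DC DC (snd Z (pt k (AlgebraicClosure k))).left
      (Z ◁ (geomPt k' ≫ c₀)) (Z ◁ (geomPt k' ≫ c₁))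

/-! ## Degrees of line bundles -/

/-- The structure map `k ⟶ Γ(X, ⊤)` of a `k`-scheme. -/
def scalars {X : Scheme.{u}} (f : X ⟶ Spec (.of k)) : k →+* Γ(X, ⊤) :=
  ((Scheme.ΓSpecIso (.of k)).inv ≫ f.appTop).hom

/-- A global function `s` on the total space of the `𝔾ₘ`-bundle of `H` is a global section of the
line bundle `H^n`: `s (v t) = t⁻ⁿ s (v)`. -/
def LineBundle.IsSection {Y : Scheme.{u}} (H : LineBundle Y) (n : ℤ) (s : Γ(H.tot, ⊤)) : Prop :=
  ∀ (T : Scheme.{u}) (v : T ⟶ H.tot) (t : Γ(T, ⊤)ˣ),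
    ((t ^ n : Γ(T, ⊤)ˣ) : Γ(T, ⊤)) * (H.act v t).appTop.hom s = v.appTop.hom s

/-- `H` is ample (on a quasi-compact scheme `Y`): every point has an affine neighbourhood which is
the non-vanishing locus of a section of some positive power of `H`. -/
def LineBundle.IsAmple {Y : Scheme.{u}} (H : LineBundle Y) : Prop :=
  ∀ y : Y, ∃ (n : ℕ) (s : Γ(H.tot, ⊤)) (U : Y.Opens), 0 < n ∧ H.IsSection n s ∧
    y ∈ U ∧ IsAffineOpen U ∧ H.proj ⁻¹ᵁ U = H.tot.basicOpen s

/-- Multiplication by `(s, t) ∈ 𝔾ₘ × 𝔾ₘ` on the fibre product of two `𝔾ₘ`-bundles. -/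
def LineBundle.act₂ {Y : Scheme.{u}} (L H : LineBundle Y) {T : Scheme.{u}}
    (x : T ⟶ Limits.pullback L.proj H.proj) (s t : Γ(T, ⊤)ˣ) :
    T ⟶ Limits.pullback L.proj H.proj :=
  pullback.lift (L.act (x ≫ pullback.fst _ _) s) (H.act (x ≫ pullback.snd _ _) t) (by
    rw [L.act_proj, H.act_proj, Category.assoc, Category.assoc, pullback.condition])

/-- `dim_k H⁰(Z, L^a ⊗ H^n)`. The sections of `L^a ⊗ H^n` are the functions `x` on the fibre
product of the `𝔾ₘ`-bundles of `L` and `H` with `x (l s, h t) = s⁻ᵃ t⁻ⁿ x (l, h)`. (They form a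
subspace already, so the span only equips them with the structure of a `k`-vector space.) -/
def h0 {Z : Over (Spec (.of k))} (L H : LineBundle Z.left) (a n : ℤ) : ℕ :=
  letI : Module k Γ(Limits.pullback L.proj H.proj, ⊤) :=
    Module.compHom _ (scalars (pullback.fst L.proj H.proj ≫ L.proj ≫ Z.hom))
  Module.finrank k (Submodule.span k {x : Γ(Limits.pullback L.proj H.proj, ⊤) |
    ∀ (T : Scheme.{u}) (v : T ⟶ Limits.pullback L.proj H.proj) (s t : Γ(T, ⊤)ˣ),
      ((s ^ a * t ^ n : Γ(T, ⊤)ˣ) : Γ(T, ⊤)) * (L.act₂ H v s t).appTop.hom x = v.appTop.hom x})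

/-- The degree of `L` with respect to the polarization `H`. For large `n` the number `h⁰(L ⊗ H^n)`
is the value at `n` of the Hilbert polynomial of `L`, and
`h⁰(L ⊗ H^n) - h⁰(H^n) = (L · H^(d-1)) n^(d-1) / (d-1)! + O(n^(d-2))`, with `d = dim Z`. -/
def degree {Z : Over (Spec (.of k))} (H L : LineBundle Z.left) : ℝ :=
  let d : ℕ := ((topologicalKrullDim Z.left).unbotD 0).toNat
  Filter.limUnder Filter.atTop fun n : ℕ =>
    ((d - 1).factorial : ℝ) * ((h0 L H 1 n : ℝ) - (h0 L H 0 n : ℝ)) / (n : ℝ) ^ (d - 1)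

/-! ## Reductive groups, parabolic subgroups, characters -/

/-- The geometric fibre over `k̄`. -/
abbrev geomFibre (G : Over (Spec (.of k))) : Over (Spec (.of (AlgebraicClosure k))) :=
  (Over.pullback (Spec.map (CommRingCat.ofHom (algebraMap k (AlgebraicClosure k))))).obj G

/-- `T` is isomorphic to `𝔾ₘ^r` for some `r`. -/
def IsSplitTorus (T : Over (Spec (.of k))) [GrpObj T] : Prop :=
  ∃ (r : ℕ) (e : ∀ S : Over (Spec (.of k)), (S ⟶ T) ≃* (Fin r → Γ(S.left, ⊤)ˣ)),
    ∀ (S S' : Over (Spec (.of k))) (h : S' ⟶ S) (t : S ⟶ T) (i : Fin r),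
      e S' (h ≫ t) i = Units.map h.left.appTop.hom (e S t i)

/-- `i : T ⟶ G` is the inclusion of a split torus which, over `k̄`, is a maximal torus of `G`. -/
def IsSplitMaximalTorus {G T : Over (Spec (.of k))} [GrpObj G] [GrpObj T] (i : T ⟶ G) : Prop :=
  IsMonHom i ∧ IsClosedImmersion i.left ∧ IsSplitTorus T ∧
  ∀ (T' : Over (Spec (.of (AlgebraicClosure k)))) (_ : GrpObj T') (i' : T' ⟶ geomFibre G)
    (j : geomFibre T ⟶ T'), IsMonHom i' → IsClosedImmersion i'.left → IsSplitTorus T' →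
    j ≫ i' = (Over.pullback _).map i → IsIso j

/-- A smooth affine group `N` over an algebraically closed field is unipotent: for each rational
point `x`, the right translation by `x` is locally unipotent on the ring of functions. -/
def IsUnipotentGroup (N : Over (Spec (.of k))) [GrpObj N] : Prop :=
  ∀ (x : 𝟙_ (Over (Spec (.of k))) ⟶ N) (a : Γ(N.left, ⊤)), ∃ n : ℕ,
    (fun b : Γ(N.left, ⊤) => ((𝟙 N * (toUnit N ≫ x) : N ⟶ N).left.appTop.hom b - b))^[n] a = 0

/-- `i : N ⟶ G` is the inclusion of a normal subgroup. -/
def IsNormalSubgroup {G N : Over (Spec (.of k))} [GrpObj G] [GrpObj N] (i : N ⟶ G) : Prop :=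
  IsMonHom i ∧ IsClosedImmersion i.left ∧
  ∀ (S : Over (Spec (.of k))) (g : S ⟶ G) (x : S ⟶ N), ∃ y : S ⟶ N, y ≫ i = g * (x ≫ i) * g⁻¹

/-- Connected split reductive groups over `k`: smooth connected affine groups with trivial
geometric unipotent radical and with a split maximal torus. -/
structure IsConnectedSplitReductive (G : Over (Spec (.of k))) [GrpObj G] : Prop where
  affine : IsAffine G.left
  smooth : Smooth G.hom
  connected : ConnectedSpace G.left
  reductive : ∀ (N : Over (Spec (.of (AlgebraicClosure k)))) (_ : GrpObj N) (i : N ⟶ geomFibre G),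
    IsNormalSubgroup i → Smooth N.hom → ConnectedSpace N.left → IsUnipotentGroup N → IsIso N.hom
  split : ∃ (T : Over (Spec (.of k))) (_ : GrpObj T) (i : T ⟶ G), IsSplitMaximalTorus i

/-- `i : P ⟶ G` is the inclusion of a parabolic subgroup: a smooth closed subgroup such that
`q : G ⟶ Q = G/P` exists with `Q` proper over `k`. (`q` being an fppf `P`-torsor means that `Q` is
the quotient.) -/
def IsParabolic {G P : Over (Spec (.of k))} [GrpObj G] [GrpObj P] (i : P ⟶ G) : Prop :=
  IsMonHom i ∧ IsClosedImmersion i.left ∧ Smooth P.hom ∧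
  ∃ (Q : Over (Spec (.of k))) (q : G ⟶ Q), IsProper Q.hom ∧ Flat q.left ∧ Surjective q.left ∧
    LocallyOfFinitePresentation q.left ∧ IsPullback (fst G P) (G ◁ i ≫ μ[G]) q q

/-- Characters `P ⟶ 𝔾ₘ`, as group-like units in the ring of functions of `P`. -/
structure Character (P : Over (Spec (.of k))) [GrpObj P] where
  unit : Γ(P.left, ⊤)ˣ
  map_mul : ∀ (S : Over (Spec (.of k))) (x y : S ⟶ P),
    Units.map (x * y).left.appTop.hom.toMonoidHom unit =
      Units.map x.left.appTop.hom.toMonoidHom unit * Units.map y.left.appTop.hom.toMonoidHom unit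

/-- The value of a character at a point. -/
def Character.eval {P : Over (Spec (.of k))} [GrpObj P] (χ : Character P) {S : Over (Spec (.of k))}
    (x : S ⟶ P) : Γ(S.left, ⊤)ˣ :=
  Units.map x.left.appTop.hom.toMonoidHom χ.unit

/-- Homomorphisms of group schemes `SL₂ ⟶ G`, on points. -/
structure SL2Hom (G : Over (Spec (.of k))) [GrpObj G] where
  app : ∀ S : Over (Spec (.of k)), Matrix.SpecialLinearGroup (Fin 2) Γ(S.left, ⊤) →* (S ⟶ G)
  naturality : ∀ (S S' : Over (Spec (.of k))) (h : S' ⟶ S)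
    (A : Matrix.SpecialLinearGroup (Fin 2) Γ(S.left, ⊤)),
    h ≫ app S A = app S' (Matrix.SpecialLinearGroup.map h.left.appTop.hom A)

/-- The matrix `(1 a; 0 1)`. -/
def upper {R : Type u} [CommRing R] (a : R) : Matrix.SpecialLinearGroup (Fin 2) R :=
  ⟨!![1, a; 0, 1], by simp [Matrix.det_fin_two_of]⟩

/-- The matrix `(1 0; a 1)`. -/
def lower {R : Type u} [CommRing R] (a : R) : Matrix.SpecialLinearGroup (Fin 2) R :=
  ⟨!![1, 0; a, 1], by simp [Matrix.det_fin_two_of]⟩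

/-- The matrix `(s 0; 0 s⁻¹)`. -/
def diag {R : Type u} [CommRing R] (s : Rˣ) : Matrix.SpecialLinearGroup (Fin 2) R :=
  ⟨!![(s : R), 0; 0, ((s⁻¹ : Rˣ) : R)], by simp [Matrix.det_fin_two_of]⟩

/-- `φ : SL₂ ⟶ G` is the homomorphism attached to the root `α` of the split maximal torus
`i : T ⟶ G`: it maps the upper and lower unipotent matrices isomorphically to the root groups
`U_α` and `U_{-α}`, and the diagonal to `T`. Then `s ↦ φ (diag s)` is the coroot of `α`. -/
structure IsRootHom {G T : Over (Spec (.of k))} [GrpObj G] [GrpObj T] (i : T ⟶ G)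
    (α : Character T) (φ : SL2Hom G) : Prop where
  upper_injective : ∀ S : Over (Spec (.of k)),
    Function.Injective fun a : Γ(S.left, ⊤) => φ.app S (upper a)
  lower_injective : ∀ S : Over (Spec (.of k)),
    Function.Injective fun a : Γ(S.left, ⊤) => φ.app S (lower a)
  conj_upper : ∀ (S : Over (Spec (.of k))) (t : S ⟶ T) (a : Γ(S.left, ⊤)),
    (t ≫ i) * φ.app S (upper a) * (t ≫ i)⁻¹ = φ.app S (upper ((α.eval t : Γ(S.left, ⊤)) * a))
  conj_lower : ∀ (S : Over (Spec (.of k))) (t : S ⟶ T) (a : Γ(S.left, ⊤)),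
    (t ≫ i) * φ.app S (lower a) * (t ≫ i)⁻¹ =
      φ.app S (lower (((α.eval t)⁻¹ : Γ(S.left, ⊤)ˣ) * a))
  diag_mem : ∀ (S : Over (Spec (.of k))) (s : Γ(S.left, ⊤)ˣ),
    ∃ t : S ⟶ T, t ≫ i = φ.app S (diag s)

/-- The character `χ` of the parabolic subgroup `i : P ⟶ G` is antidominant: for each split maximal
torus `T ⊆ P` of `G` and each root `α` with `U_α ⊆ P`, one has `⟨χ, α^∨⟩ ≤ 0`.
(For roots `α` with also `U_{-α} ⊆ P` this says that `⟨χ, α^∨⟩ = 0`, which is automatic. So one gets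
the same as with the positive roots of a Borel subgroup contained in `P`.) -/
def Character.IsAntidominant {G P : Over (Spec (.of k))} [GrpObj G] [GrpObj P] (i : P ⟶ G)
    (χ : Character P) : Prop :=
  ∀ (T : Over (Spec (.of k))) (_ : GrpObj T) (j : T ⟶ P) (α : Character T) (φ : SL2Hom G),
    IsMonHom j → IsSplitMaximalTorus (j ≫ i) → IsRootHom (j ≫ i) α φ →
    (∀ (S : Over (Spec (.of k))) (a : Γ(S.left, ⊤)), ∃ y : S ⟶ P, y ≫ i = φ.app S (upper a)) →
    ∀ n : ℤ, (∀ (S : Over (Spec (.of k))) (s : Γ(S.left, ⊤)ˣ) (y : S ⟶ P),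
      y ≫ i = φ.app S (diag s) → χ.eval y = s ^ n) → n ≤ 0

/-- The character `χ` of `P` is trivial on the scheme-theoretic center of `P`. -/
def Character.IsTrivialOnCenter {P : Over (Spec (.of k))} [GrpObj P] (χ : Character P) : Prop :=
  ∀ (S : Over (Spec (.of k))) (z : S ⟶ P),
    (∀ (S' : Over (Spec (.of k))) (h : S' ⟶ S) (x : S' ⟶ P), (h ≫ z) * x = x * (h ≫ z)) →
    χ.eval z = 1

/-! ## `R`-stability -/

/-- `j : Q ⟶ E` is a reduction of the structure group of `E` to `i : P ⟶ G`, i.e. a section of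
`E/P ⟶ Z` given by the `P`-bundle `Q` that it defines. -/
def IsReduction {B : Scheme.{u}} {G P : Over B} [GrpObj G] [GrpObj P] (i : P ⟶ G) {Z : Over B}
    {E : GBundle G Z} {Q : GBundle P Z} (j : Q.tot ⟶ E.tot) : Prop :=
  j ≫ E.proj = Q.proj ∧ Q.act ≫ j = (j ⊗ₘ i) ≫ E.act

/-- The line bundle `L` is `χ_* Q`: there is a `χ`-equivariant map over `Z` from `Q` to the
`𝔾ₘ`-bundle of `L`. -/
def IsAssociatedLineBundle {P Z : Over (Spec (.of k))} [GrpObj P] (χ : Character P)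
    (Q : GBundle P Z) (L : LineBundle Z.left) : Prop :=
  ∃ q : Q.tot.left ⟶ L.tot, q ≫ L.proj = Q.proj.left ∧
    ∀ (S : Over (Spec (.of k))) (v : S ⟶ Q.tot) (g : S ⟶ P),
      (lift v g ≫ Q.act).left ≫ q = L.act (v.left ≫ q) (χ.eval g)

/-- `R`-stability of a `G`-Higgs bundle (`c = 0`) or of an integrable `G`-connection (`c = 1`) with
respect to the polarization `H`: for each proper parabolic subgroup `P`, each reduction `Q` to `P`
compatible with `D` (i.e. `D` is induced by a `D_Q` on `Q`), and each non-trivial antidominant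
character `χ` of `P` which is trivial on the center of `P`, one has `deg χ_* Q > 0`. -/
def IsRStable {c : ℤ} {G : Over (Spec (.of k))} [GrpObj G] {Z : Over (Spec (.of k))}
    (H : LineBundle Z.left) {E : GBundle G Z} (D : LambdaConnection c E Z.hom) : Prop :=
  ∀ (P : Over (Spec (.of k))) (_ : GrpObj P) (i : P ⟶ G), IsParabolic i → ¬ IsIso i →
  ∀ (Q : GBundle P Z) (j : Q.tot ⟶ E.tot), IsReduction i j →
    (∃ DQ : LambdaConnection c Q Z.hom, ∀ (U : Z.left.Opens) (u : RelVectorField Z.hom U),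
      Related j.left (DQ.toFun U u) (D.toFun U u)) →
  ∀ χ : Character P, χ.unit ≠ 1 → χ.IsAntidominant i → χ.IsTrivialOnCenter →
  ∀ L : LineBundle Z.left, IsAssociatedLineBundle χ Q L → 0 < degree H L

/-! ## Frobenius pullback -/

variable (p : ℕ) [Fact p.Prime] [CharP k p]

/-- The Frobenius morphism of `Spec k`. -/
abbrev frobSpec (k : Type u) [Field k] (p : ℕ) [Fact p.Prime] [CharP k p] :
    Spec (.of k) ⟶ Spec (.of k) :=
  Spec.map (CommRingCat.ofHom (frobenius k p))

/-- The Frobenius twist `Z' = Z ×_{k, Frob} k`. -/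
abbrev frobTwist (Z : Over (Spec (.of k))) : Over (Spec (.of k)) :=
  (Over.pullback (frobSpec k p)).obj Z

/-- The projection `π_{Z/k} : Z' ⟶ Z`. -/
abbrev frobProj (Z : Over (Spec (.of k))) : (frobTwist p Z).left ⟶ Z.left :=
  pullback.fst Z.hom (frobSpec k p)

/-- The pullback of a `G`-bundle along `π_{Z/k} : Z' ⟶ Z`. A priori it is a principal bundle under
the Frobenius twist of `G`, which is identified with `G` by `φ`. -/
def GBundle.frobPullback {G Z : Over (Spec (.of k))} [GrpObj G] (E : GBundle G Z)
    (φ : frobTwist p G ≅ G) [IsMonHom φ.hom] : GBundle G (frobTwist p Z) :=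
  (E.baseChange (frobSpec k p)).transport φ

/-- `D'` is the pullback of `D` along `π_{Z/k} : Z' ⟶ Z`. -/
def IsFrobPullback {c : ℤ} {G Z : Over (Spec (.of k))} [GrpObj G] {E : GBundle G Z}
    {φ : frobTwist p G ≅ G} [IsMonHom φ.hom]
    (D' : LambdaConnection c (E.frobPullback p φ) (frobTwist p Z).hom)
    (D : LambdaConnection c E Z.hom) : Prop :=
  PullsBackAlong D' D (frobProj p E.tot) (frobProj p Z)

end Field

end HiggsRig

end

open HiggsRig

/-!
Over a perfect field `k` the Frobenius of `Spec k` is an automorphism, so that the projection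
`π : Z' ⟶ Z` of the Frobenius twist is an isomorphism of schemes, although not of `k`-schemes. All
notions in question are invariant under such semilinear isomorphisms, and the theorem is obtained by
transport of structure.

An isomorphism `b : B' ≅ B` of bases being fixed, `OverIso b X' X` is the type of isomorphisms from
the `B'`-scheme `X'` to the `B`-scheme `X` which cover `b`, and `Comm x y f' f` says that the
morphisms `f'` over `B'` and `f` over `B` correspond to each other. This correspondence respects
composition, products and cartesian squares, and every `B'`-scheme corresponds to some `B`-scheme,
with the same underlying scheme (`twist`). Both notions are symmetric, so most transports have to be
proved in one direction only.

An isomorphism of principal bundles covering an isomorphism of their bases transports vector fields,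
and hence connections: `BundleComm.exists_pullsBackAlong` and `PullsBackAlong.unique`. This gives
existence and uniqueness of `π^*(E, D)`.

For rigidity, a family over `C` is moved to a family over the twist of `C`. Its points with values
in a finite extension `K` of `k` are moved by an automorphism of `Spec K` compatible with the one of
`Spec k`. It exists since the Frobenius of an algebraic closure preserves all intermediate fields,
which are themselves perfect (`frobAut`, `ClosureAut.isRigid_iff_of_corr`).

For stability, the data consisting of a parabolic subgroup, a reduction, a character and the
associated line bundle are moved from `Z'` to `Z`. The spaces of sections which define the degree
are semilinearly isomorphic, so they have the same dimension (`degree_eq`, `IsRStable.of_corr`).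
-/

noncomputable section

namespace HiggsRig

/-! ### Isomorphisms covering an isomorphism of base schemes -/

section PullbackMap

variable {X' Y' B' X Y B : Scheme.{u}} {f' : X' ⟶ B'} {g' : Y' ⟶ B'} {f : X ⟶ B} {g : Y ⟶ B}

theorem pullback_map_fst (x : X' ⟶ X) (y : Y' ⟶ Y) (b : B' ⟶ B) (hf : f' ≫ b = x ≫ f)
    (hg : g' ≫ b = y ≫ g) :
    pullback.map f' g' f g x y b hf hg ≫ pullback.fst f g = pullback.fst f' g' ≫ x :=
  pullback.lift_fst _ _ _

theorem pullback_map_snd (x : X' ⟶ X) (y : Y' ⟶ Y) (b : B' ⟶ B) (hf : f' ≫ b = x ≫ f)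
    (hg : g' ≫ b = y ≫ g) :
    pullback.map f' g' f g x y b hf hg ≫ pullback.snd f g = pullback.snd f' g' ≫ y :=
  pullback.lift_snd _ _ _

/-- The isomorphism of fibre products induced by an isomorphism of cospans. -/
def pullbackMapIso (x : X' ≅ X) (y : Y' ≅ Y) (b : B' ≅ B) (hf : f' ≫ b.hom = x.hom ≫ f)
    (hg : g' ≫ b.hom = y.hom ≫ g) : pullback f' g' ≅ pullback f g where
  hom := pullback.map f' g' f g x.hom y.hom b.hom hf hg
  inv := pullback.map f g f' g' x.inv y.inv b.inv
    (by rw [Iso.comp_inv_eq, Category.assoc, hf, Iso.inv_hom_id_assoc])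
    (by rw [Iso.comp_inv_eq, Category.assoc, hg, Iso.inv_hom_id_assoc])
  hom_inv_id := by
    apply pullback.hom_ext
    · rw [Category.assoc, pullback_map_fst, ← Category.assoc, pullback_map_fst, Category.assoc,
        Iso.hom_inv_id, Category.comp_id, Category.id_comp]
    · rw [Category.assoc, pullback_map_snd, ← Category.assoc, pullback_map_snd, Category.assoc,
        Iso.hom_inv_id, Category.comp_id, Category.id_comp]
  inv_hom_id := by
    apply pullback.hom_ext
    · rw [Category.assoc, pullback_map_fst, ← Category.assoc, pullback_map_fst, Category.assoc,
        Iso.inv_hom_id, Category.comp_id, Category.id_comp]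
    · rw [Category.assoc, pullback_map_snd, ← Category.assoc, pullback_map_snd, Category.assoc,
        Iso.inv_hom_id, Category.comp_id, Category.id_comp]

variable (x : X' ≅ X) (y : Y' ≅ Y) (b : B' ≅ B) (hf : f' ≫ b.hom = x.hom ≫ f)
    (hg : g' ≫ b.hom = y.hom ≫ g)

theorem pullbackMapIso_hom_fst : (pullbackMapIso x y b hf hg).hom ≫ pullback.fst f g =
    pullback.fst f' g' ≫ x.hom :=
  pullback.lift_fst _ _ _

theorem pullbackMapIso_hom_snd : (pullbackMapIso x y b hf hg).hom ≫ pullback.snd f g =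
    pullback.snd f' g' ≫ y.hom :=
  pullback.lift_snd _ _ _

end PullbackMap

/-- An isomorphism from the `B'`-scheme `X'` to the `B`-scheme `X` covering the isomorphism
`b : B' ≅ B`. -/
structure OverIso {B' B : Scheme.{u}} (b : B' ≅ B) (X' : Over B') (X : Over B) where
  iso : X'.left ≅ X.left
  w : iso.hom ≫ X.hom = X'.hom ≫ b.hom

namespace OverIso

variable {B' B : Scheme.{u}} {b : B' ≅ B}

/-- The inverse, covering the inverse of the isomorphism of bases. -/
@[simps iso]
def symm {X' : Over B'} {X : Over B} (x : OverIso b X' X) : OverIso b.symm X X' where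
  iso := x.iso.symm
  w := by
    rw [Iso.symm_hom, Iso.inv_comp_eq, Iso.symm_hom, ← Category.assoc, Iso.eq_comp_inv, x.w]

/-- The `B`-scheme obtained from a `B'`-scheme by composing the structure map with `b`. -/
abbrev twist (b : B' ≅ B) (X' : Over B') : Over B := Over.mk (X'.hom ≫ b.hom)

/-- The identity of the underlying scheme, as an isomorphism from `X'` to its twist. -/
def toTwist (b : B' ≅ B) (X' : Over B') : OverIso b X' (twist b X') where
  iso := Iso.refl _
  w := by simp

/-- The identity of the underlying scheme, as an isomorphism to `X` from its twist by the inverse of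
`b`. -/
def ofTwist (b : B' ≅ B) (X : Over B) : OverIso b (twist b.symm X) X where
  iso := Iso.refl _
  w := by simp

/-- Morphisms `f'` over `B'` and `f` over `B` which correspond to each other. -/
def Comm {X' Y' : Over B'} {X Y : Over B} (x : OverIso b X' X) (y : OverIso b Y' Y)
    (f' : X' ⟶ Y') (f : X ⟶ Y) : Prop :=
  x.iso.hom ≫ f.left = f'.left ≫ y.iso.hom

variable {X' Y' Z' W' : Over B'} {X Y Z W : Over B} (x : OverIso b X' X) (y : OverIso b Y' Y)
  (z : OverIso b Z' Z) (v : OverIso b W' W)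

/-- The bijection between morphisms over `B'` and morphisms over `B`. -/
def tr : (X' ⟶ Y') ≃ (X ⟶ Y) where
  toFun f' := Over.homMk (x.iso.inv ≫ f'.left ≫ y.iso.hom) (by simp [y.w, Iso.inv_comp_eq, x.w])
  invFun f := Over.homMk (x.iso.hom ≫ f.left ≫ y.iso.inv) (by
    have := y.symm.w
    simp only [symm_iso, Iso.symm_hom] at this
    simp [this, reassoc_of% x.w])
  left_inv f' := by ext1; simp
  right_inv f := by ext1; simp

variable {x y z v}

theorem comm_tr (f' : X' ⟶ Y') : Comm x y f' (tr x y f') := by simp [Comm, tr]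

theorem comm_tr_symm (f : X ⟶ Y) : Comm x y ((tr x y).symm f) f := by simp [Comm, tr]

namespace Comm

theorem symm {f' : X' ⟶ Y'} {f : X ⟶ Y} (h : Comm x y f' f) : Comm x.symm y.symm f f' := by
  simp only [Comm, symm_iso, Iso.symm_hom] at h ⊢
  rw [Iso.inv_comp_eq, ← Category.assoc, h, Category.assoc, Iso.hom_inv_id, Category.comp_id]

theorem unique {f' : X' ⟶ Y'} {f g : X ⟶ Y} (hf : Comm x y f' f) (hg : Comm x y f' g) : f = g := by
  ext1
  rw [← cancel_epi x.iso.hom, hf, hg]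

theorem unique' {f' g' : X' ⟶ Y'} {f : X ⟶ Y} (hf : Comm x y f' f) (hg : Comm x y g' f) :
    f' = g' :=
  hf.symm.unique hg.symm

theorem tr_eq {f' : X' ⟶ Y'} {f : X ⟶ Y} (h : Comm x y f' f) : tr x y f' = f :=
  (comm_tr f').unique h

theorem comp {f' : X' ⟶ Y'} {f : X ⟶ Y} {g' : Y' ⟶ Z'} {g : Y ⟶ Z} (hf : Comm x y f' f)
    (hg : Comm y z g' g) : Comm x z (f' ≫ g') (f ≫ g) := by
  simp only [Comm] at hf hg ⊢
  rw [Over.comp_left, reassoc_of% hf, hg, Over.comp_left, Category.assoc]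

theorem id (x : OverIso b X' X) : Comm x x (𝟙 X') (𝟙 X) := by simp [Comm]

theorem isIso {f' : X' ⟶ Y'} {f : X ⟶ Y} (h : Comm x y f' f) [IsIso f'] : IsIso f :=
  ⟨tr y x (inv f'), (h.comp (comm_tr _)).unique (by rw [IsIso.hom_inv_id]; exact id x),
    ((comm_tr _).comp h).unique (by rw [IsIso.inv_hom_id]; exact id y)⟩

theorem arrowIso {f' : X' ⟶ Y'} {f : X ⟶ Y} (h : Comm x y f' f) :
    Nonempty (Arrow.mk f'.left ≅ Arrow.mk f.left) :=
  ⟨Arrow.isoMk x.iso y.iso h⟩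

theorem property {f' : X' ⟶ Y'} {f : X ⟶ Y} (h : Comm x y f' f) {P : MorphismProperty Scheme.{u}}
    [P.IsStableUnderBaseChange] (hf : P f'.left) : P f.left :=
  have := MorphismProperty.IsStableUnderBaseChange.respectsIso (P := P)
  (P.arrow_mk_iso_iff h.arrowIso.some).1 hf

end Comm

theorem property_hom (x : OverIso b X' X) {P : MorphismProperty Scheme.{u}}
    [P.IsStableUnderBaseChange] (hX : P X'.hom) : P X.hom :=
  have := MorphismProperty.IsStableUnderBaseChange.respectsIso (P := P)
  (P.arrow_mk_iso_iff (Arrow.isoMk x.iso b x.w : Arrow.mk X'.hom ≅ Arrow.mk X.hom)).1 hX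

/-- The isomorphism of terminal objects. -/
def unit (b : B' ≅ B) : OverIso b (𝟙_ (Over B')) (𝟙_ (Over B)) where
  iso := b
  w := by simp [Over.tensorUnit_hom]

theorem comm_toUnit : Comm x (unit b) (toUnit X') (toUnit X) := by
  simpa [Comm, Over.toUnit_left, unit] using x.w

/-- The isomorphism of products. -/
def tensor (x : OverIso b X' X) (y : OverIso b Y' Y) : OverIso b (X' ⊗ Y') (X ⊗ Y) where
  iso := pullbackMapIso x.iso y.iso b x.w.symm y.w.symm
  w := by
    rw [Over.tensorObj_hom, Over.tensorObj_hom, ← Category.assoc, pullbackMapIso_hom_fst,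
      Category.assoc, Category.assoc, x.w]

theorem comm_fst : Comm (x.tensor y) x (fst X' Y') (fst X Y) := by
  exact pullback.lift_fst _ _ _

theorem comm_snd : Comm (x.tensor y) y (snd X' Y') (snd X Y) := by
  exact pullback.lift_snd _ _ _

theorem tensor_symm : x.symm.tensor y.symm = (x.tensor y).symm := rfl

namespace Comm

theorem lift {f' : X' ⟶ Y'} {f : X ⟶ Y} {g' : X' ⟶ Z'} {g : X ⟶ Z} (hf : Comm x y f' f)
    (hg : Comm x z g' g) : Comm x (y.tensor z) (lift f' g') (lift f g) := by
  have : tr x (y.tensor z) (CartesianMonoidalCategory.lift f' g') =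
      CartesianMonoidalCategory.lift f g := by
    apply CartesianMonoidalCategory.hom_ext
    · exact ((comm_tr _).comp comm_fst).unique (by simpa using hf)
    · exact ((comm_tr _).comp comm_snd).unique (by simpa using hg)
  exact this ▸ comm_tr _

theorem tensorHom {f' : X' ⟶ Y'} {f : X ⟶ Y} {g' : Z' ⟶ W'} {g : Z ⟶ W} (hf : Comm x y f' f)
    (hg : Comm z v g' g) : Comm (x.tensor z) (y.tensor v) (f' ⊗ₘ g') (f ⊗ₘ g) := by
  have := (comm_fst (x := x) (y := z).comp hf).lift (comm_snd (x := x) (y := z).comp hg)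
  simpa [CartesianMonoidalCategory.lift_fst_comp_snd_comp] using this

theorem whiskerLeft {g' : Z' ⟶ W'} {g : Z ⟶ W} (hg : Comm z v g' g) :
    Comm (x.tensor z) (x.tensor v) (X' ◁ g') (X ◁ g) := by
  simpa using (id x).tensorHom hg

theorem whiskerRight {g' : Z' ⟶ W'} {g : Z ⟶ W} (hg : Comm z v g' g) :
    Comm (z.tensor x) (v.tensor x) (g' ▷ X') (g ▷ X) := by
  simpa using hg.tensorHom (id x)

end Comm

theorem comm_rightUnitor :
    Comm (x.tensor (unit b)) x (ρ_ X').hom (ρ_ X).hom := by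
  simpa [CartesianMonoidalCategory.rightUnitor_hom] using comm_fst (x := x) (y := unit b)

theorem comm_leftUnitor :
    Comm ((unit b).tensor x) x (λ_ X').hom (λ_ X).hom := by
  simpa [CartesianMonoidalCategory.leftUnitor_hom] using comm_snd (x := unit b) (y := x)

theorem comm_associator :
    Comm ((x.tensor y).tensor z) (x.tensor (y.tensor z)) (α_ X' Y' Z').hom (α_ X Y Z).hom := by
  have h := (comm_fst (x := x.tensor y) (y := z).comp comm_fst).lift
    ((comm_fst (x := x.tensor y) (y := z).comp comm_snd).lift comm_snd)
  convert h using 1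
  · ext1 <;> [skip; ext1] <;> simp
  · ext1 <;> [skip; ext1] <;> simp

/-- Cartesian squares over `B'` correspond to cartesian squares over `B`. -/
theorem isPullback {f' : X' ⟶ Y'} {g' : X' ⟶ Z'} {h' : Y' ⟶ W'} {k' : Z' ⟶ W'}
    {f : X ⟶ Y} {g : X ⟶ Z} {h : Y ⟶ W} {k : Z ⟶ W} (hf : Comm x y f' f) (hg : Comm x z g' g)
    (hh : Comm y v h' h) (hk : Comm z v k' k) (H : IsPullback f' g' h' k') :
    IsPullback f g h k := by
  refine ⟨⟨(hf.comp hh).unique (H.w ▸ hg.comp hk)⟩, ⟨PullbackCone.IsLimit.mk _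
    (fun s => tr (ofTwist b s.pt) x (H.lift ((tr (ofTwist b s.pt) y).symm s.fst)
      ((tr (ofTwist b s.pt) z).symm s.snd)
      (((comm_tr_symm _).comp hh).unique' (s.condition ▸ (comm_tr_symm _).comp hk))))
    (fun s => ?_) (fun s => ?_) (fun s m h₁ h₂ => ?_)⟩⟩
  · exact ((comm_tr _).comp hf).unique (by rw [H.lift_fst]; exact comm_tr_symm _)
  · exact ((comm_tr _).comp hg).unique (by rw [H.lift_snd]; exact comm_tr_symm _)
  · rw [← Equiv.symm_apply_eq]
    apply H.hom_ext
    · rw [H.lift_fst]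
      exact ((comm_tr_symm m).comp hf).unique' (h₁ ▸ comm_tr_symm _)
    · rw [H.lift_snd]
      exact ((comm_tr_symm m).comp hg).unique' (h₂ ▸ comm_tr_symm _)

theorem Comm.toTwist_left {f' : X' ⟶ Y'} {f : twist b X' ⟶ Y} (h : Comm (toTwist b X') y f' f) :
    f.left = f'.left ≫ y.iso.hom := by
  rw [← show _ = f'.left ≫ y.iso.hom from h]
  exact (Category.id_comp _).symm

theorem Comm.ofTwist_left {f' : twist b.symm X ⟶ Y'} {f : X ⟶ Y} (h : Comm (ofTwist b X) y f' f) :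
    f.left = f'.left ≫ y.iso.hom := by
  rw [← show _ = f'.left ≫ y.iso.hom from h]
  exact (Category.id_comp _).symm

/-! ### Group schemes -/

/-- The isomorphism `g` of group schemes is multiplicative. -/
def IsMul {G' : Over B'} {G : Over B} [GrpObj G'] [GrpObj G] (g : OverIso b G' G) : Prop :=
  Comm (g.tensor g) g μ[G'] μ[G]

section Group

variable {G' H' : Over B'} {G H : Over B} [GrpObj G'] [GrpObj G] [GrpObj H'] [GrpObj H]
  {g : OverIso b G' G} {h : OverIso b H' H}

theorem IsMul.symm (hg : g.IsMul) : g.symm.IsMul := by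
  have := Comm.symm hg
  simp only [IsMul, Comm] at this ⊢
  rwa [tensor_symm]

theorem IsMul.mul (hg : g.IsMul) {f₁' f₂' : X' ⟶ G'} {f₁ f₂ : X ⟶ G} (h₁ : Comm x g f₁' f₁)
    (h₂ : Comm x g f₂' f₂) : Comm x g (f₁' * f₂') (f₁ * f₂) := by
  rw [Hom.mul_def, Hom.mul_def]
  exact (h₁.lift h₂).comp hg

/-- The isomorphism of groups of points. -/
def trMul (x : OverIso b X' X) (hg : g.IsMul) : (X' ⟶ G') ≃* (X ⟶ G) :=
  { tr x g with
    map_mul' := fun _ _ => (hg.mul (comm_tr _) (comm_tr _)).tr_eq }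

theorem IsMul.one (hg : g.IsMul) : Comm x g 1 1 := by
  have : trMul x hg 1 = 1 := map_one _
  exact this ▸ comm_tr _

theorem IsMul.inv (hg : g.IsMul) {f' : X' ⟶ G'} {f : X ⟶ G} (h : Comm x g f' f) :
    Comm x g f'⁻¹ f⁻¹ := by
  have h₁ : trMul x hg f'⁻¹ = (trMul x hg f')⁻¹ := map_inv _ _
  have h₂ : trMul x hg f' = f := h.tr_eq
  rw [← h₂, ← h₁]
  exact comm_tr _

theorem IsMul.comm_eta (hg : g.IsMul) : Comm (unit b) g η[G'] η[G] := by
  simpa [Hom.one_def] using hg.one (x := unit b)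

theorem isMonHom (hg : g.IsMul) (hh : h.IsMul) {f' : G' ⟶ H'} {f : G ⟶ H} (hf : Comm g h f' f)
    (H : IsMonHom f') : IsMonHom f where
  one_hom := (hg.comm_eta.comp hf).unique (by rw [H.one_hom]; exact hh.comm_eta)
  mul_hom := (Comm.comp hg hf).unique (by rw [H.mul_hom]; exact (hf.tensorHom hf).comp hh)

/-- The transport of a group structure to the twist. The group axioms are equalities between
morphisms which correspond to the two sides of the axioms of `G'`. -/
@[reducible]
def twistGrpObj (b : B' ≅ B) (G' : Over B') [GrpObj G'] : GrpObj (twist b G') where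
  one := tr (unit b) (toTwist b G') η
  mul := tr ((toTwist b G').tensor (toTwist b G')) (toTwist b G') μ
  inv := tr (toTwist b G') (toTwist b G') ι
  one_mul := ((Comm.whiskerRight (comm_tr _)).comp (comm_tr _)).unique
    (by rw [MonObj.one_mul]; exact comm_leftUnitor)
  mul_one := ((Comm.whiskerLeft (comm_tr _)).comp (comm_tr _)).unique
    (by rw [MonObj.mul_one]; exact comm_rightUnitor)
  mul_assoc := ((Comm.whiskerRight (comm_tr _)).comp (comm_tr _)).unique
    (by
      rw [MonObj.mul_assoc]
      exact comm_associator.comp ((comm_tr _).whiskerLeft.comp (comm_tr _)))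
  left_inv := (((comm_tr _).lift (Comm.id _)).comp (comm_tr _)).unique
    (by rw [GrpObj.left_inv]; exact comm_toUnit.comp (comm_tr _))
  right_inv := (((Comm.id _).lift (comm_tr _)).comp (comm_tr _)).unique
    (by rw [GrpObj.right_inv]; exact comm_toUnit.comp (comm_tr _))

theorem toTwist_isMul : let _ := twistGrpObj b G'; (toTwist b G').IsMul := by
  let _ := twistGrpObj b G'
  exact comm_tr _

end Group

end OverIso

/-! ### Vector fields and isomorphisms -/

section AppLE

variable {X Y Z : Scheme.{u}}

theorem appLE_appLE (f : X ⟶ Y) (g : Y ⟶ Z) {U : Z.Opens} {V : Y.Opens} {W : X.Opens}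
    (e₁ : V ≤ g ⁻¹ᵁ U) (e₂ : W ≤ f ⁻¹ᵁ V) (x : Γ(Z, U)) :
    f.appLE V W e₂ (g.appLE U V e₁ x) =
      (f ≫ g).appLE U W (e₂.trans fun _ hx => e₁ hx) x := by
  rw [← Scheme.Hom.appLE_comp_appLE f g U V W e₁ e₂, CommRingCat.comp_apply]

theorem appLE_congr_hom {f g : X ⟶ Y} (h : f = g) {U : Y.Opens} {V : X.Opens} (e : V ≤ f ⁻¹ᵁ U)
    (x : Γ(Y, U)) : f.appLE U V e x = g.appLE U V (h ▸ e) x := by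
  subst h
  rfl

theorem appLE_id {U V : X.Opens} (e : V ≤ U) (x : Γ(X, U)) :
    (𝟙 X : X ⟶ X).appLE U V e x = X.presheaf.map (homOfLE e).op x := rfl

theorem appLE_id_self {U : X.Opens} (x : Γ(X, U)) :
    (𝟙 X : X ⟶ X).appLE U U le_rfl x = x :=
  congr($(X.presheaf.map_id _) x)

theorem appLE_map_apply (f : X ⟶ Y) {U : Y.Opens} {V V' : X.Opens} (e : V ≤ f ⁻¹ᵁ U) (i : V' ≤ V)
    (x : Γ(Y, U)) : X.presheaf.map (homOfLE i).op (f.appLE U V e x) =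
      f.appLE U V' (i.trans e) x := by
  rw [← Scheme.Hom.appLE_map f e (homOfLE i).op, CommRingCat.comp_apply]

theorem map_appLE_apply (f : X ⟶ Y) {U U' : Y.Opens} {V : X.Opens} (e : V ≤ f ⁻¹ᵁ U) (i : U ≤ U')
    (x : Γ(Y, U')) : f.appLE U V e (Y.presheaf.map (homOfLE i).op x) =
      f.appLE U' V (e.trans fun _ hx => i hx) x := by
  rw [← Scheme.Hom.map_appLE f e (homOfLE i).op, CommRingCat.comp_apply]

theorem le_inv_preimage (h : X ≅ Y) (W : X.Opens) : W ≤ h.hom ⁻¹ᵁ h.inv ⁻¹ᵁ W := by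
  rw [← Scheme.Hom.comp_preimage, h.hom_inv_id]
  rfl

theorem inv_preimage_le (h : X ≅ Y) {W : X.Opens} {U : Y.Opens} (e : W ≤ h.hom ⁻¹ᵁ U) :
    h.inv ⁻¹ᵁ W ≤ U := by
  have : h.inv ⁻¹ᵁ h.hom ⁻¹ᵁ U = U := by
    rw [← Scheme.Hom.comp_preimage, h.inv_hom_id]
    rfl
  exact this ▸ fun _ hx => e hx

/-- Sections over an open set and over its image under an isomorphism. -/
def sectionEquiv (h : X ≅ Y) (W : X.Opens) : Γ(Y, h.inv ⁻¹ᵁ W) ≃+* Γ(X, W) where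
  toFun := h.hom.appLE _ _ (le_inv_preimage h W)
  invFun := h.inv.appLE _ _ le_rfl
  left_inv x := by rw [appLE_appLE, appLE_congr_hom h.inv_hom_id, appLE_id_self]
  right_inv x := by rw [appLE_appLE, appLE_congr_hom h.hom_inv_id, appLE_id_self]
  map_add' := map_add _
  map_mul' := map_mul _

end AppLE

/-- Transport of derivations along an isomorphism of rings. -/
def conjDerivation {R R' : Type*} [CommRing R] [CommRing R'] (e : R ≃+* R')
    (D : Derivation ℤ R R) : Derivation ℤ R' R' :=
  Derivation.mk' ((e : R →+ R').comp
      ((D : R →ₗ[ℤ] R).toAddMonoidHom.comp (e.symm : R' →+ R))).toIntLinearMap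
    (fun x y => by simp)

@[simp]
theorem conjDerivation_apply {R R' : Type*} [CommRing R] [CommRing R'] (e : R ≃+* R')
    (D : Derivation ℤ R R) (x : R') : conjDerivation e D x = e (D (e.symm x)) := rfl

section

variable {Y' S' Y S : Scheme.{u}} {f' : Y' ⟶ S'} {f : Y ⟶ S}

namespace RelVectorField

theorem ext_der {U : Y.Opens} {D₁ D₂ : RelVectorField f U}
    (h : ∀ (W : Y.Opens) (hW : W ≤ U) (x : Γ(Y, W)), D₁.der W hW x = D₂.der W hW x) :
    D₁ = D₂ := by
  cases D₁
  cases D₂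
  congr 1
  funext W hW
  exact Derivation.ext (h W hW)

/-- The vector field on `Y'` which is related to a given one on `Y`, for an isomorphism `Y' ≅ Y`
covering an isomorphism of the bases. -/
def pull (h : Y' ≅ Y) (s : S' ≅ S) (w : h.hom ≫ f = f' ≫ s.hom) {U : Y.Opens}
    (u : RelVectorField f U) (U' : Y'.Opens) (e : U' ≤ h.hom ⁻¹ᵁ U) : RelVectorField f' U' where
  der W' hW' := conjDerivation (sectionEquiv h W')
    (u.der (h.inv ⁻¹ᵁ W') (inv_preimage_le h (hW'.trans e)))
  der_res W V hW i x := by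
    have hV : h.inv ⁻¹ᵁ V ≤ h.inv ⁻¹ᵁ W := fun _ hx => i hx
    have := u.der_res _ _ (inv_preimage_le h (hW.trans e)) hV ((sectionEquiv h W).symm x)
    simp only [conjDerivation_apply]
    change h.hom.appLE _ _ _ (u.der _ _ (h.inv.appLE _ _ _ _)) = Y'.presheaf.map _
      (h.hom.appLE _ _ _ _)
    change u.der _ _ (Y.presheaf.map _ (h.inv.appLE _ _ _ x)) = _ at this
    rw [appLE_map_apply] at this
    rw [map_appLE_apply, this, map_appLE_apply, appLE_map_apply]
  der_base R W hW e' t := by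
    have h₁ : h.inv ≫ f' = f ≫ s.inv := by
      rw [Iso.inv_comp_eq, ← Category.assoc, w, Category.assoc, Iso.hom_inv_id, Category.comp_id]
    have h₂ : h.inv ⁻¹ᵁ W ≤ f ⁻¹ᵁ (s.inv ⁻¹ᵁ R) := by
      rw [← Scheme.Hom.comp_preimage, ← h₁]
      exact fun _ hx => e' hx
    have h₃ : (sectionEquiv h W).symm (f'.appLE R W e' t) =
        f.appLE _ _ h₂ (s.inv.appLE R _ le_rfl t) := by
      change h.inv.appLE _ _ _ _ = _
      rw [appLE_appLE, appLE_appLE]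
      exact appLE_congr_hom h₁ _ _
    rw [conjDerivation_apply, h₃, u.der_base, map_zero]

end RelVectorField

namespace Related

theorem pull (h : Y' ≅ Y) (s : S' ≅ S) (w : h.hom ≫ f = f' ≫ s.hom) {U : Y.Opens}
    (u : RelVectorField f U) (U' : Y'.Opens) (e : U' ≤ h.hom ⁻¹ᵁ U) :
    Related h.hom (u.pull h s w U' e) u := by
  intro W hW W' hW' e' x
  change h.hom.appLE _ _ _ (u.der _ _ (h.inv.appLE _ _ _ _)) = _
  have h₁ : h.inv ⁻¹ᵁ W' ≤ W := inv_preimage_le h e'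
  rw [appLE_appLE, appLE_congr_hom h.inv_hom_id, appLE_id h₁, u.der_res _ _ hW h₁, map_appLE_apply]

section

variable {h : Y' ⟶ Y} {U' : Y'.Opens} {U : Y.Opens} {u' v' : RelVectorField f' U'}
  {u v : RelVectorField f U}

theorem add (hu : Related h u' u) (hv : Related h v' v) : Related h (u' + v') (u + v) := by
  intro W hW W' hW' e x
  change u'.der _ _ _ + v'.der _ _ _ = h.appLE W W' e (u.der _ _ _ + v.der _ _ _)
  rw [hu _ hW _ _ e, hv _ hW _ _ e, map_add]

theorem smul (hu : Related h u' u) {a' : Γ(Y', U')} {a : Γ(Y, U)} (e : U' ≤ h ⁻¹ᵁ U)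
    (ha : h.appLE U U' e a = a') : Related h (a' • u') (a • u) := by
  intro W hW W' hW' e x
  change Y'.presheaf.map _ a' * u'.der _ _ _ = h.appLE W W' e (Y.presheaf.map _ a * u.der _ _ _)
  rw [hu _ hW _ _ e, map_mul, ← ha, appLE_map_apply, map_appLE_apply]

theorem bracket (hu : Related h u' u) (hv : Related h v' v) : Related h ⁅u', v'⁆ ⁅u, v⁆ := by
  intro W hW W' hW' e x
  change ⁅u'.der _ _, v'.der _ _⁆ _ = h.appLE W W' e (⁅u.der _ _, v.der _ _⁆ _)
  rw [Derivation.commutator_apply, Derivation.commutator_apply, map_sub, hv _ hW _ _ e,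
    hu _ hW _ _ e, hu _ hW _ _ e, hv _ hW _ _ e]

theorem restrict (hu : Related h u' u) {V' : Y'.Opens} (i' : V' ≤ U') {V : Y.Opens} (i : V ≤ U) :
    Related h (u'.restrict i') (u.restrict i) :=
  fun W hW W' hW' e x => hu W (hW.trans i) W' (hW'.trans i') e x

theorem restrict_left (hu : Related h u' u) {V' : Y'.Opens} (i' : V' ≤ U') :
    Related h (u'.restrict i') u :=
  fun W hW W' hW' e x => hu W hW W' (hW'.trans i') e x

theorem restrict_right (hu : Related h u' u) {V : Y.Opens} (i : V ≤ U) :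
    Related h u' (u.restrict i) :=
  fun W hW W' hW' e x => hu W (hW.trans i) W' hW' e x

/-- Relatedness only depends on the vector field near the image of `h`. -/
theorem of_restrict_right {V : Y.Opens} (i : V ≤ U) (e : U' ≤ h ⁻¹ᵁ V)
    (hu : Related h u' (u.restrict i)) : Related h u' u := by
  intro W hW W' hW' e' x
  have h₀ : W' ≤ h ⁻¹ᵁ (W ⊓ V) := fun y hy => ⟨e' hy, e (hW' hy)⟩
  have h₁ := hu (W ⊓ V) inf_le_right W' hW' h₀
    (Y.presheaf.map (homOfLE inf_le_left).op x)
  change _ = h.appLE _ _ _ (u.der _ _ _) at h₁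
  rwa [map_appLE_apply, u.der_res _ _ hW inf_le_left, map_appLE_apply] at h₁

end

section

variable {h : Y' ≅ Y} {U' : Y'.Opens} {U : Y.Opens} {u' v' : RelVectorField f' U'}
  {u v : RelVectorField f U}

/-- A vector field on `Y'` is determined by a related one on `Y`, for an isomorphism `Y' ≅ Y`. -/
theorem eq_of_le (e : U' ≤ h.hom ⁻¹ᵁ U) (hu : Related h.hom u' u) (hv : Related h.hom v' u) :
    u' = v' := by
  refine RelVectorField.ext_der fun W' hW' x => ?_
  obtain ⟨y, rfl⟩ := (sectionEquiv h W').surjective x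
  exact (hu _ (inv_preimage_le h (hW'.trans e)) _ hW' (le_inv_preimage h W') y).trans
    (hv _ (inv_preimage_le h (hW'.trans e)) _ hW' (le_inv_preimage h W') y).symm

theorem symm (e : U' ≤ h.hom ⁻¹ᵁ U) (hu : Related h.hom u' u) : Related h.inv u u' := by
  intro W' hW' W hW e' x
  obtain ⟨y, rfl⟩ := (sectionEquiv h W').surjective x
  have h₁ := hu _ (inv_preimage_le h (hW'.trans e)) _ hW' (le_inv_preimage h W') y
  have h₂ : W ≤ h.inv ⁻¹ᵁ W' := e'
  change u.der W hW (h.inv.appLE _ _ _ (h.hom.appLE _ _ _ y)) =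
    h.inv.appLE _ _ _ (u'.der _ _ (h.hom.appLE _ _ _ y))
  rw [h₁, appLE_appLE, appLE_appLE, appLE_congr_hom h.inv_hom_id, appLE_congr_hom h.inv_hom_id,
    appLE_id h₂, appLE_id h₂, u.der_res]

end

/-- Relatedness is invariant under isomorphisms of the morphism along which it is considered. -/
theorem conj {X' X T' T : Scheme.{u}} {q' : X' ⟶ T'} {q : X ⟶ T} {y' : Y' ≅ X'} {y : Y ≅ X}
    {h : Y' ⟶ Y} {k : X' ⟶ X} (w : y'.hom ≫ k = h ≫ y.hom) {U' : Y'.Opens} {U : Y.Opens}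
    {V' : X'.Opens} {V : X.Opens} {u' : RelVectorField f' U'} {u : RelVectorField f U}
    {v' : RelVectorField q' V'} {v : RelVectorField q V} (e' : U' ≤ y'.hom ⁻¹ᵁ V')
    (e : U ≤ y.hom ⁻¹ᵁ V) (hu' : Related y'.hom u' v') (hu : Related y.hom u v)
    (hv : Related k v' v) : Related h u' u := by
  intro W hW W' hW' eW x
  obtain ⟨x, rfl⟩ := (sectionEquiv y W).surjective x
  have h₁ : y'.inv ⁻¹ᵁ W' ≤ k ⁻¹ᵁ y.inv ⁻¹ᵁ W := by
    rw [← Scheme.Hom.comp_preimage]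
    apply inv_preimage_le
    rw [← Scheme.Hom.comp_preimage, reassoc_of% w, y.hom_inv_id, Category.comp_id]
    exact eW
  have h₂ : y.inv ⁻¹ᵁ W ≤ V := inv_preimage_le y (hW.trans e)
  have h₃ : y'.inv ⁻¹ᵁ W' ≤ V' := inv_preimage_le y' (hW'.trans e')
  change u'.der _ _ (h.appLE _ _ _ (y.hom.appLE _ _ _ x)) =
    h.appLE _ _ _ (u.der _ _ (y.hom.appLE _ _ _ x))
  rw [hu _ h₂, appLE_appLE, appLE_appLE, appLE_congr_hom w.symm, appLE_congr_hom w.symm,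
    ← appLE_appLE _ _ h₁ (le_inv_preimage y' W'), ← appLE_appLE _ _ h₁ (le_inv_preimage y' W'),
    hu' _ h₃, hv _ h₂]

end Related

end

open OverIso

/-! ### Principal bundles and connections under isomorphisms -/

section Bundles

variable {B' B : Scheme.{u}} {b : B' ≅ B} {G' : Over B'} {G : Over B} [GrpObj G'] [GrpObj G]
  {g : OverIso b G' G}

/-- The isomorphism `m` of total spaces is an isomorphism from the `G'`-bundle `E'` on `Y'` to the
`G`-bundle `E` on `Y`, covering `g : G' ≅ G` and `y : Y' ≅ Y`. -/
structure BundleComm (g : OverIso b G' G) {Y' : Over B'} {Y : Over B} (y : OverIso b Y' Y)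
    (E' : GBundle G' Y') (E : GBundle G Y) (m : OverIso b E'.tot E.tot) : Prop where
  proj : Comm m y E'.proj E.proj
  act : Comm (m.tensor g) m E'.act E.act

/-- Transport of a principal bundle to an isomorphic base. -/
def pullGBundle (hg : g.IsMul) {Y' : Over B'} {Y : Over B} (y : OverIso b Y' Y) (E : GBundle G Y) :
    GBundle G' Y' where
  tot := twist b.symm E.tot
  proj := (tr (ofTwist b E.tot) y).symm E.proj
  act := (tr ((ofTwist b E.tot).tensor g) (ofTwist b E.tot)).symm E.act
  act_one := ((Comm.whiskerLeft hg.comm_eta).comp (comm_tr_symm _)).unique'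
    (by rw [E.act_one]; exact comm_rightUnitor)
  act_mul := ((Comm.whiskerRight (comm_tr_symm _)).comp (comm_tr_symm _)).unique'
    (by rw [E.act_mul]; exact comm_associator.comp ((Comm.whiskerLeft hg).comp (comm_tr_symm _)))
  flat := (comm_tr_symm E.proj).symm.property (P := @Flat) E.flat
  surjective := (comm_tr_symm E.proj).symm.property (P := @Surjective) E.surjective
  locallyOfFinitePresentation := (comm_tr_symm E.proj).symm.property
    (P := @LocallyOfFinitePresentation) E.locallyOfFinitePresentation
  torsor := isPullback comm_fst.symm (comm_tr_symm _).symm (comm_tr_symm _).symm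
    (comm_tr_symm _).symm E.torsor

theorem bundleComm_pullGBundle (hg : g.IsMul) {Y' : Over B'} {Y : Over B} (y : OverIso b Y' Y)
    (E : GBundle G Y) : BundleComm g y (pullGBundle hg y E) E (ofTwist b E.tot) :=
  ⟨comm_tr_symm _, comm_tr_symm _⟩

/-- The isomorphism `y` covers an isomorphism of the targets of `f'` and `f`. -/
def BaseCompat {Y' S' Y S : Scheme.{u}} (y : Y' ≅ Y) (f' : Y' ⟶ S') (f : Y ⟶ S) : Prop :=
  ∃ s : S' ≅ S, y.hom ≫ f = f' ≫ s.hom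

theorem BaseCompat.symm {Y' S' Y S : Scheme.{u}} {y : Y' ≅ Y} {f' : Y' ⟶ S'} {f : Y ⟶ S}
    (h : BaseCompat y f' f) : BaseCompat y.symm f f' := by
  obtain ⟨s, w⟩ := h
  refine ⟨s.symm, ?_⟩
  rw [Iso.symm_hom, Iso.inv_comp_eq, ← Category.assoc, w, Iso.symm_hom, Category.assoc,
    Iso.hom_inv_id, Category.comp_id]

theorem BaseCompat.exists_related {Y' S' Y S : Scheme.{u}} {y : Y' ≅ Y} {f' : Y' ⟶ S'} {f : Y ⟶ S}
    (h : BaseCompat y f' f) {U : Y.Opens} (u : RelVectorField f U) {U' : Y'.Opens}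
    (e : U' ≤ y.hom ⁻¹ᵁ U) : ∃ u' : RelVectorField f' U', Related y.hom u' u := by
  obtain ⟨s, w⟩ := h
  exact ⟨_, Related.pull y s w u U' e⟩

/-- The vector field `u'` may be replaced by its restriction to an open set which is only
propositionally equal to its domain. -/
theorem Related.of_restrict_left {Y' S' Y S : Scheme.{u}} {f' : Y' ⟶ S'} {f : Y ⟶ S} {h : Y' ⟶ Y}
    {U' V' : Y'.Opens} {U : Y.Opens} {u' : RelVectorField f' U'} {u : RelVectorField f U}
    (i : V' ≤ U') (j : U' ≤ V') (hu : Related h (u'.restrict i) u) : Related h u' u :=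
  fun W hW W' hW' e x => hu W hW W' (hW'.trans j) e x

variable {Y' : Over B'} {Y : Over B} {y : OverIso b Y' Y} {E' : GBundle G' Y'} {E : GBundle G Y}
  {m : OverIso b E'.tot E.tot}

namespace BundleComm

theorem symm (h : BundleComm g y E' E m) : BundleComm g.symm y.symm E E' m.symm :=
  ⟨h.proj.symm, h.act.symm⟩

theorem preimage_le (h : BundleComm g y E' E m) {U' : Y'.left.Opens} {U : Y.left.Opens}
    (e : U' ≤ y.iso.hom ⁻¹ᵁ U) :
    E'.proj.left ⁻¹ᵁ U' ≤ m.iso.hom ⁻¹ᵁ (E.proj.left ⁻¹ᵁ U) := by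
  have h₁ : m.iso.hom ≫ E.proj.left = E'.proj.left ≫ y.iso.hom := h.proj
  rw [← Scheme.Hom.comp_preimage, h₁, Scheme.Hom.comp_preimage]
  exact fun _ hx => e hx

theorem baseCompat (h : BundleComm g y E' E m) {S' S : Scheme.{u}} {f' : Y'.left ⟶ S'}
    {f : Y.left ⟶ S} (hf : BaseCompat y.iso f' f) :
    BaseCompat m.iso (E'.proj.left ≫ f') (E.proj.left ≫ f) := by
  obtain ⟨s, w⟩ := hf
  have h₁ : m.iso.hom ≫ E.proj.left = E'.proj.left ≫ y.iso.hom := h.proj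
  exact ⟨s, by rw [reassoc_of% h₁, w, Category.assoc]⟩

theorem isInvariant (h : BundleComm g y E' E m) {S' S : Scheme.{u}} {f' : E'.tot.left ⟶ S'}
    {f : E.tot.left ⟶ S} {U' : Y'.left.Opens} {U : Y.left.Opens} (e : U' ≤ y.iso.hom ⁻¹ᵁ U)
    {u' : RelVectorField f' (E'.proj.left ⁻¹ᵁ U')} {u : RelVectorField f (E.proj.left ⁻¹ᵁ U)}
    (hu : Related m.iso.hom u' u) (H : E.IsInvariant u) : E'.IsInvariant u' := by
  obtain ⟨v, h₁, h₂⟩ := H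
  have hf : (m.tensor g).iso.hom ≫ (fst E.tot G).left = (fst E'.tot G').left ≫ m.iso.hom :=
    comm_fst
  have hs : (m.tensor g).iso.hom ≫ (snd E.tot G).left = (snd E'.tot G').left ≫ g.iso.hom :=
    comm_snd
  have e₁ := h.preimage_le e
  have e₂ : (fst E'.tot G').left ⁻¹ᵁ (E'.proj.left ⁻¹ᵁ U') ≤
      (m.tensor g).iso.hom ⁻¹ᵁ ((fst E.tot G).left ⁻¹ᵁ (E.proj.left ⁻¹ᵁ U)) := by
    rw [← Scheme.Hom.comp_preimage (m.tensor g).iso.hom, hf, Scheme.Hom.comp_preimage _ m.iso.hom]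
    exact fun _ hx => e₁ hx
  obtain ⟨v', hv⟩ := BaseCompat.exists_related ⟨g.iso, hs⟩ v e₂
  exact ⟨v', Related.conj hf e₂ e₁ hv hu h₁, Related.conj h.act e₂ e₁ hv hu h₂⟩

end BundleComm

variable {c : ℤ} {S' S : Scheme.{u}} {f' : Y'.left ⟶ S'} {f : Y.left ⟶ S}
  {D' : LambdaConnection c E' f'} {D : LambdaConnection c E f}

theorem LambdaConnection.ext_toFun {D₁ D₂ : LambdaConnection c E f}
    (h : ∀ U u, D₁.toFun U u = D₂.toFun U u) : D₁ = D₂ := by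
  cases D₁
  cases D₂
  congr 1
  funext U u
  exact h U u

/-- For an isomorphism, compatibility of the connections also holds on open sets which are not
literally the preimage of each other. -/
theorem PullsBackAlong.related (hm : BundleComm g y E' E m)
    (hD : PullsBackAlong D' D m.iso.hom y.iso.hom) {U' : Y'.left.Opens} {U : Y.left.Opens}
    (e : U' ≤ y.iso.hom ⁻¹ᵁ U) {u' : RelVectorField f' U'} {u : RelVectorField f U}
    (hu : Related y.iso.hom u' u) : Related m.iso.hom (D'.toFun U' u') (D.toFun U u) := by
  have i : y.iso.inv ⁻¹ᵁ U' ≤ U := inv_preimage_le _ e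
  have j : U' ≤ y.iso.hom ⁻¹ᵁ y.iso.inv ⁻¹ᵁ U' := le_inv_preimage _ _
  have j' : y.iso.hom ⁻¹ᵁ y.iso.inv ⁻¹ᵁ U' ≤ U' := by
    rw [← Scheme.Hom.comp_preimage, Iso.hom_inv_id]
    exact le_rfl
  have h := hD _ (u.restrict i) (u'.restrict j') (hu.restrict _ _)
  rw [D'.map_restrict, D.map_restrict] at h
  exact (h.of_restrict_right _ (hm.preimage_le le_rfl)).of_restrict_left _ fun _ hx => j hx

theorem PullsBackAlong.symm (hm : BundleComm g y E' E m)
    (hD : PullsBackAlong D' D m.iso.hom y.iso.hom) :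
    PullsBackAlong D D' m.iso.inv y.iso.inv := by
  intro U' u' u hu
  have e : U' ≤ y.iso.hom ⁻¹ᵁ y.iso.inv ⁻¹ᵁ U' := le_inv_preimage _ _
  exact (hD.related hm e (Related.symm (h := y.iso.symm) le_rfl hu)).symm (hm.preimage_le e)

theorem PullsBackAlong.unique (hf : BaseCompat y.iso f' f) (hm : BundleComm g y E' E m)
    {D₁ D₂ : LambdaConnection c E' f'} (h₁ : PullsBackAlong D₁ D m.iso.hom y.iso.hom)
    (h₂ : PullsBackAlong D₂ D m.iso.hom y.iso.hom) : D₁ = D₂ := by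
  refine LambdaConnection.ext_toFun fun U' u' => ?_
  obtain ⟨u, hu⟩ := hf.symm.exists_related u' (U' := y.iso.inv ⁻¹ᵁ U') le_rfl
  have e : U' ≤ y.iso.hom ⁻¹ᵁ y.iso.inv ⁻¹ᵁ U' := le_inv_preimage _ _
  have hu' := Related.symm (h := y.iso.symm) le_rfl hu
  exact Related.eq_of_le (hm.preimage_le e) (h₁.related hm e hu') (h₂.related hm e hu')

/-- Transport of connections along isomorphisms of principal bundles. Each axiom for the transported
connection follows from the one for `D`, because a vector field on `E'` is determined by a related
one on `E`. -/
theorem BundleComm.exists_pullsBackAlong (hm : BundleComm g y E' E m) (hf : BaseCompat y.iso f' f)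
    (D : LambdaConnection c E f) :
    ∃ D' : LambdaConnection c E' f', PullsBackAlong D' D m.iso.hom y.iso.hom := by
  have hP : m.iso.hom ≫ E.proj.left = E'.proj.left ≫ y.iso.hom := hm.proj
  have j (U' : Y'.left.Opens) : U' ≤ y.iso.hom ⁻¹ᵁ y.iso.inv ⁻¹ᵁ U' := le_inv_preimage _ _
  choose F hF using fun (U' : Y'.left.Opens) (u' : RelVectorField f' U') =>
    hf.symm.exists_related u' (U' := y.iso.inv ⁻¹ᵁ U') le_rfl
  have hF' (U' : Y'.left.Opens) (u' : RelVectorField f' U') : Related y.iso.hom u' (F U' u') :=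
    Related.symm (h := y.iso.symm) le_rfl (hF U' u')
  choose T hT using fun (U' : Y'.left.Opens) (u' : RelVectorField f' U') =>
    (hm.baseCompat hf).exists_related (D.toFun _ (F U' u')) (hm.preimage_le (j U'))
  -- `T` is compatible with `D` on all pairs of open sets, not only on those used to define it.
  have key {U' : Y'.left.Opens} {U : Y.left.Opens} (e : U' ≤ y.iso.hom ⁻¹ᵁ U)
      {u' : RelVectorField f' U'} {u : RelVectorField f U} (hu : Related y.iso.hom u' u) :
      Related m.iso.hom (T U' u') (D.toFun U u) := by
    have i : y.iso.inv ⁻¹ᵁ U' ≤ U := inv_preimage_le _ e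
    have h₁ : F U' u' = u.restrict i :=
      Related.eq_of_le (h := y.iso.symm) le_rfl (hF U' u') ((hu.restrict_right i).symm (j U'))
    have h₂ := hT U' u'
    rw [h₁, D.map_restrict] at h₂
    exact h₂.of_restrict_right _ (hm.preimage_le (j U'))
  refine ⟨{ toFun := T, map_add := ?_, map_smul := ?_, map_restrict := ?_, invariant := ?_,
            anchor := ?_, integrable := ?_ }, fun U u u' hu => key le_rfl hu⟩
  · intro U' u' v'
    have h := key (j U') ((hF' U' u').add (hF' U' v'))
    rw [D.map_add] at h
    exact h.eq_of_le (hm.preimage_le (j U')) ((hT U' u').add (hT U' v'))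
  · intro U' a' u'
    obtain ⟨a, rfl⟩ := (sectionEquiv y.iso U').surjective a'
    have h := key (j U') ((hF' U' u').smul (j U') (a := a) rfl)
    rw [D.map_smul] at h
    refine h.eq_of_le (hm.preimage_le (j U')) ((hT U' u').smul (hm.preimage_le (j U')) ?_)
    rw [Scheme.Hom.app_eq_appLE, Scheme.Hom.app_eq_appLE, appLE_appLE]
    change _ = E'.proj.left.appLE _ _ _ (y.iso.hom.appLE _ _ _ a)
    rw [appLE_appLE]
    exact appLE_congr_hom hP _ _
  · intro U' V' i u'
    have h := key (i.trans (j U')) ((hF' U' u').restrict_left i)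
    exact h.eq_of_le (hm.preimage_le (i.trans (j U'))) ((hT U' u').restrict_left _)
  · intro U' u'
    exact hm.isInvariant (j U') (hT U' u') (D.invariant _ _)
  · intro U' u' W' hW' x
    obtain ⟨x, rfl⟩ := (sectionEquiv y.iso W').surjective x
    have hW : y.iso.inv ⁻¹ᵁ W' ≤ y.iso.inv ⁻¹ᵁ U' := fun _ hx => hW' hx
    have e := hm.preimage_le (j W')
    have h₁ (z : Γ(Y.left, y.iso.inv ⁻¹ᵁ W')) :
        E'.proj.left.app W' (y.iso.hom.appLE _ _ (j W') z) =
          m.iso.hom.appLE _ _ e (E.proj.left.app _ z) := by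
      rw [Scheme.Hom.app_eq_appLE, Scheme.Hom.app_eq_appLE, appLE_appLE, appLE_appLE]
      exact appLE_congr_hom hP.symm _ _
    change (T U' u').der _ _ (E'.proj.left.app W' (y.iso.hom.appLE _ _ (j W') x)) =
      c • E'.proj.left.app W' (u'.der W' hW' (y.iso.hom.appLE _ _ (j W') x))
    have h₂ := hT U' u' (E.proj.left ⁻¹ᵁ y.iso.inv ⁻¹ᵁ W') (fun _ hx => hW hx)
      (E'.proj.left ⁻¹ᵁ W') (fun _ hx => hW' hx) e (E.proj.left.app _ x)
    rw [D.anchor _ _ _ hW, map_zsmul] at h₂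
    rw [hF' U' u' _ hW, h₁, h₁]
    exact h₂
  · intro U' u' v' W' hW' x
    obtain ⟨x, rfl⟩ := (sectionEquiv m.iso W').surjective x
    have hW : m.iso.inv ⁻¹ᵁ W' ≤ E.proj.left ⁻¹ᵁ y.iso.inv ⁻¹ᵁ U' :=
      inv_preimage_le _ (hW'.trans (hm.preimage_le (j U')))
    have h₁ := (hT U' u').bracket (hT U' v') _ hW _ hW' (le_inv_preimage _ _) x
    have h₂ := key (j U') ((hF' U' u').bracket (hF' U' v')) _ hW _ hW' (le_inv_preimage _ _) x
    refine h₁.trans ?_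
    rw [D.integrable, map_zsmul, ← h₂]
    rfl

/-- `D'` and `D` correspond to each other under some isomorphism of the underlying bundles. -/
def Corr (g : OverIso b G' G) (y : OverIso b Y' Y) (D' : LambdaConnection c E' f')
    (D : LambdaConnection c E f) : Prop :=
  ∃ m : OverIso b E'.tot E.tot, BundleComm g y E' E m ∧ PullsBackAlong D' D m.iso.hom y.iso.hom

theorem Corr.symm (h : Corr g y D' D) : Corr g.symm y.symm D D' := by
  obtain ⟨m, hm, hD⟩ := h
  exact ⟨m.symm, hm.symm, hD.symm hm⟩

theorem exists_corr (hg : g.IsMul) (y : OverIso b Y' Y) (hf : BaseCompat y.iso f' f)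
    (D : LambdaConnection c E f) :
    ∃ (E' : GBundle G' Y') (D' : LambdaConnection c E' f'), Corr g y D' D := by
  obtain ⟨D', hD⟩ := (bundleComm_pullGBundle hg y E).exists_pullsBackAlong hf D
  exact ⟨_, D', _, bundleComm_pullGBundle hg y E, hD⟩

end Bundles

section Pullbacks

variable {B' B : Scheme.{u}} {b : B' ≅ B} {G' : Over B'} {G : Over B} [GrpObj G'] [GrpObj G]
  {g : OverIso b G' G} {c : ℤ}
  {Y' Y₁' Y₂' : Over B'} {Y Y₁ Y₂ : Over B}
  {y : OverIso b Y' Y} {y₁ : OverIso b Y₁' Y₁} {y₂ : OverIso b Y₂' Y₂}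
  {S' S S₁' S₁ S₂' S₂ : Scheme.{u}}
  {f' : Y'.left ⟶ S'} {f : Y.left ⟶ S} {f₁' : Y₁'.left ⟶ S₁'} {f₁ : Y₁.left ⟶ S₁}
  {f₂' : Y₂'.left ⟶ S₂'} {f₂ : Y₂.left ⟶ S₂}
  {E' : GBundle G' Y'} {E : GBundle G Y} {E₁' : GBundle G' Y₁'} {E₁ : GBundle G Y₁}
  {E₂' : GBundle G' Y₂'} {E₂ : GBundle G Y₂}
  {D' : LambdaConnection c E' f'} {D : LambdaConnection c E f}
  {D₁' : LambdaConnection c E₁' f₁'} {D₁ : LambdaConnection c E₁ f₁}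
  {D₂' : LambdaConnection c E₂' f₂'} {D₂ : LambdaConnection c E₂ f₂}

/-- Being a pullback is invariant under isomorphisms of both connections. The comparison of vector
fields is moved back and forth by `Related.conj`. -/
theorem IsPullbackOf.corr (hf : BaseCompat y.iso f' f) (hf₁ : BaseCompat y₁.iso f₁' f₁)
    (hD : Corr g y D' D) (hD₁ : Corr g y₁ D₁' D₁) {h' : Y' ⟶ Y₁'} {h : Y ⟶ Y₁}
    (hh : Comm y y₁ h' h) (H : IsPullbackOf D D₁ h) : IsPullbackOf D' D₁' h' := by
  obtain ⟨m, hm, hmD⟩ := hD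
  obtain ⟨m₁, hm₁, hmD₁⟩ := hD₁
  obtain ⟨q, hq, hqa, hqD⟩ := H
  have hq' : Comm m m₁ ((tr m m₁).symm q) q := comm_tr_symm q
  refine ⟨(tr m m₁).symm q, OverIso.isPullback hq'.symm hm.proj.symm hm₁.proj.symm hh.symm hq,
    (hm.act.comp hq').unique' (hqa ▸ hq'.whiskerRight.comp hm₁.act), ?_⟩
  intro U' u' v' huv
  have e₁ : y₁.iso.inv ⁻¹ᵁ U' ≤ y₁.symm.iso.hom ⁻¹ᵁ U' := le_rfl
  have j : U' ≤ y₁.iso.hom ⁻¹ᵁ y₁.iso.inv ⁻¹ᵁ U' := le_inv_preimage _ _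
  have w : y.iso.hom ≫ h.left = h'.left ≫ y₁.iso.hom := hh
  have w' : y.iso.inv ≫ h'.left = h.left ≫ y₁.iso.inv := hh.symm
  have e : h.left ⁻¹ᵁ y₁.iso.inv ⁻¹ᵁ U' ≤ y.iso.inv ⁻¹ᵁ (h'.left ⁻¹ᵁ U') := by
    rw [← Scheme.Hom.comp_preimage, ← Scheme.Hom.comp_preimage, w']
  have e' : h'.left ⁻¹ᵁ U' ≤ y.iso.hom ⁻¹ᵁ (h.left ⁻¹ᵁ y₁.iso.inv ⁻¹ᵁ U') := by
    rw [← Scheme.Hom.comp_preimage y.iso.hom, w, Scheme.Hom.comp_preimage]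
    exact fun _ hx => j hx
  obtain ⟨u, hu⟩ := hf₁.symm.exists_related u' e₁
  obtain ⟨v, hv⟩ := hf.symm.exists_related v' e
  have H := hqD _ u v (Related.conj (y' := y.iso.symm) (y := y₁.iso.symm) w' e e₁ hv hu huv)
  refine Related.conj hq' (hm.preimage_le e') (hm₁.preimage_le j) ?_ ?_ H
  · exact hmD.related hm e' (Related.symm (h := y.iso.symm) e hv)
  · exact hmD₁.related hm₁ j (Related.symm (h := y₁.iso.symm) e₁ hu)

theorem IsoPullbacks.corr (hg : g.IsMul) (hf : BaseCompat y.iso f' f)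
    (hf₁ : BaseCompat y₁.iso f₁' f₁) (hf₂ : BaseCompat y₂.iso f₂' f₂) (hD₁ : Corr g y₁ D₁' D₁)
    (hD₂ : Corr g y₂ D₂' D₂) {h₁' : Y' ⟶ Y₁'} {h₁ : Y ⟶ Y₁} {h₂' : Y' ⟶ Y₂'} {h₂ : Y ⟶ Y₂}
    (hh₁ : Comm y y₁ h₁' h₁) (hh₂ : Comm y y₂ h₂' h₂) (H : IsoPullbacks D₁ D₂ f h₁ h₂) :
    IsoPullbacks D₁' D₂' f' h₁' h₂' := by
  obtain ⟨E, D, H₁, H₂⟩ := H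
  obtain ⟨E', D', hD⟩ := exists_corr hg y hf D
  exact ⟨E', D', H₁.corr hf hf₁ hD hD₁ hh₁, H₂.corr hf hf₂ hD hD₂ hh₂⟩

end Pullbacks

/-! ### Rigidity -/

/-- The isomorphism of spectra given by an isomorphism of rings. -/
@[simps hom]
def specIso {R R' : Type u} [CommRing R] [CommRing R'] (e : R ≃+* R') :
    Spec (.of R') ≅ Spec (.of R) where
  hom := Spec.map (CommRingCat.ofHom (e : R →+* R'))
  inv := Spec.map (CommRingCat.ofHom (e.symm : R' →+* R))
  hom_inv_id := by
    rw [← Spec.map_comp, ← CommRingCat.ofHom_comp]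
    simp
  inv_hom_id := by
    rw [← Spec.map_comp, ← CommRingCat.ofHom_comp]
    simp

/-- An automorphism of the algebraic closure of `k` which preserves `k` and every intermediate
field. -/
structure ClosureAut (k : Type u) [Field k] where
  base : k ≃+* k
  aut : AlgebraicClosure k ≃+* AlgebraicClosure k
  aut_algebraMap : ∀ x, aut (algebraMap k _ x) = algebraMap k _ (base x)
  mem_iff : ∀ (K : IntermediateField k (AlgebraicClosure k)) (x : AlgebraicClosure k),
    aut x ∈ K ↔ x ∈ K

namespace ClosureAut

variable {k : Type u} [Field k] (σ : ClosureAut k)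

/-- The inverse automorphism. -/
def symm : ClosureAut k where
  base := σ.base.symm
  aut := σ.aut.symm
  aut_algebraMap x := by
    rw [RingEquiv.symm_apply_eq, σ.aut_algebraMap, RingEquiv.apply_symm_apply]
  mem_iff K x := by
    rw [← σ.mem_iff, RingEquiv.apply_symm_apply]

/-- The induced automorphism of `Spec k`. -/
abbrev spec : Spec (.of k) ≅ Spec (.of k) := specIso σ.base

/-- The induced automorphism of an intermediate field. -/
def restrict (K : IntermediateField k (AlgebraicClosure k)) : K ≃+* K where
  toFun x := ⟨σ.aut x, (σ.mem_iff K x).2 x.2⟩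
  invFun x := ⟨σ.aut.symm x, (σ.symm.mem_iff K x).2 x.2⟩
  left_inv x := by simp
  right_inv x := by simp
  map_add' x y := by ext; simp
  map_mul' x y := by ext; simp

/-- The induced automorphism of `Spec K`, for an intermediate field `K`. -/
def point (K : IntermediateField k (AlgebraicClosure k)) : OverIso σ.spec (pt k K) (pt k K) where
  iso := specIso (σ.restrict K)
  w := by
    simp only [specIso_hom, Over.mk_hom]
    rw [← Spec.map_comp, ← Spec.map_comp,
      ← CommRingCat.ofHom_comp, ← CommRingCat.ofHom_comp]
    congr 2
    ext x
    exact σ.aut_algebraMap x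

/-- The induced automorphism of `Spec k̄`. -/
def geomPoint : OverIso σ.spec (pt k (AlgebraicClosure k)) (pt k (AlgebraicClosure k)) where
  iso := specIso σ.aut
  w := by
    simp only [specIso_hom, Over.mk_hom]
    rw [← Spec.map_comp, ← Spec.map_comp,
      ← CommRingCat.ofHom_comp, ← CommRingCat.ofHom_comp]
    congr 2
    ext x
    exact σ.aut_algebraMap x

theorem comm_geomPt (K : IntermediateField k (AlgebraicClosure k)) :
    Comm σ.geomPoint (σ.point K) (geomPt K) (geomPt K) := by
  simp only [Comm, geomPoint, point, geomPt, Over.homMk_left, specIso_hom]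
  rw [← Spec.map_comp, ← Spec.map_comp, ← CommRingCat.ofHom_comp, ← CommRingCat.ofHom_comp]
  rfl

/-- A family witnessing that `D` is not rigid is transported to one for `D'`. -/
theorem isRigid_of_corr {G' G : Over (Spec (.of k))} [GrpObj G'] [GrpObj G]
    {g : OverIso σ.spec G' G} (hg : g.IsMul) {Z' Z : Over (Spec (.of k))}
    {z : OverIso σ.spec Z' Z} {c : ℤ} {E' : GBundle G' Z'} {E : GBundle G Z}
    {D' : LambdaConnection c E' Z'.hom} {D : LambdaConnection c E Z.hom} (hD : Corr g z D' D)
    (H : IsRigid D') : IsRigid D := by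
  rintro ⟨C, EC, DC, K, c₀, c₁, hft, hqc, hgi, hdim, hK, h₀, h₁⟩
  let x := ofTwist σ.spec C
  have hf : BaseCompat (z.tensor x).iso (snd Z' (twist σ.spec.symm C)).left (snd Z C).left :=
    ⟨x.iso, comm_snd⟩
  obtain ⟨EC', DC', hDC⟩ := exists_corr hg (z.tensor x) hf DC
  have hc₀ : Comm (σ.point K) x ((tr (σ.point K) x).symm c₀) c₀ := comm_tr_symm c₀
  have hc₁ : Comm (σ.point K) x ((tr (σ.point K) x).symm c₁) c₁ := comm_tr_symm c₁
  refine H ⟨twist σ.spec.symm C, EC', DC', K, (tr (σ.point K) x).symm c₀,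
    (tr (σ.point K) x).symm c₁, ?_, ?_, ?_, hdim, hK, ?_, fun h => h₁ ?_⟩
  · exact x.symm.property_hom (P := @LocallyOfFiniteType) hft
  · exact x.symm.property_hom (P := @QuasiCompact) hqc
  · exact x.symm.property_hom (P := @GeometricallyIrreducible) hgi
  · exact h₀.corr (y := z.tensor (σ.point K)) hg ⟨(σ.point K).iso, comm_snd⟩ hf ⟨σ.spec, z.w⟩ hDC hD
      hc₀.whiskerLeft comm_fst
  · exact h.corr (y := (z.tensor σ.geomPoint).symm) hg.symm
      (BaseCompat.symm ⟨σ.geomPoint.iso, comm_snd⟩) hf.symm hf.symm hDC.symm hDC.symm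
      ((σ.comm_geomPt K).comp hc₀).whiskerLeft.symm ((σ.comm_geomPt K).comp hc₁).whiskerLeft.symm

theorem isRigid_iff_of_corr {G' G : Over (Spec (.of k))} [GrpObj G'] [GrpObj G]
    {g : OverIso σ.spec G' G} (hg : g.IsMul) {Z' Z : Over (Spec (.of k))}
    {z : OverIso σ.spec Z' Z} {c : ℤ} {E' : GBundle G' Z'} {E : GBundle G Z}
    {D' : LambdaConnection c E' Z'.hom} {D : LambdaConnection c E Z.hom} (hD : Corr g z D' D) :
    IsRigid D' ↔ IsRigid D :=
  ⟨σ.isRigid_of_corr hg hD, σ.symm.isRigid_of_corr hg.symm hD.symm⟩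

end ClosureAut

/-! ### Line bundles and degrees -/

/-- The action of a morphism on global units. -/
abbrev unitsMap {X Y : Scheme.{u}} (f : X ⟶ Y) : Γ(Y, ⊤)ˣ →* Γ(X, ⊤)ˣ :=
  Units.map f.appTop.hom.toMonoidHom

theorem unitsMap_comp {X Y Z : Scheme.{u}} (f : X ⟶ Y) (g : Y ⟶ Z) (s : Γ(Z, ⊤)ˣ) :
    unitsMap (f ≫ g) s = unitsMap f (unitsMap g s) := by
  ext
  exact congr($(Scheme.Hom.comp_appTop f g) s.1)

theorem unitsMap_id {X : Scheme.{u}} (s : Γ(X, ⊤)ˣ) : unitsMap (𝟙 X) s = s := by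
  ext
  exact congr($(Scheme.Hom.id_appTop (X := X)) s.1)

/-- An isomorphism of schemes induces an isomorphism of the rings of global functions. -/
def globalEquiv {X Y : Scheme.{u}} (e : X ≅ Y) : Γ(Y, ⊤) ≃+* Γ(X, ⊤) where
  toFun := e.hom.appTop
  invFun := e.inv.appTop
  left_inv x := by
    rw [← CommRingCat.comp_apply, ← Scheme.Hom.comp_appTop, e.inv_hom_id]
    exact congr($(Scheme.Hom.id_appTop (X := Y)) x)
  right_inv x := by
    rw [← CommRingCat.comp_apply, ← Scheme.Hom.comp_appTop, e.hom_inv_id]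
    exact congr($(Scheme.Hom.id_appTop (X := X)) x)
  map_add' := map_add _
  map_mul' := map_mul _

/-- The isomorphism `l` of total spaces is an isomorphism of line bundles covering `y`. -/
structure LineComm {Y' Y : Scheme.{u}} (y : Y' ≅ Y) (L' : LineBundle Y') (L : LineBundle Y)
    (l : L'.tot ≅ L.tot) : Prop where
  proj : l.hom ≫ L.proj = L'.proj ≫ y.hom
  act : ∀ {T : Scheme.{u}} (v : T ⟶ L'.tot) (s : Γ(T, ⊤)ˣ),
    L'.act v s ≫ l.hom = L.act (v ≫ l.hom) s

/-- Push-forward of a line bundle along an isomorphism. -/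
def LineBundle.push {Y' Y : Scheme.{u}} (L : LineBundle Y') (y : Y' ≅ Y) : LineBundle Y where
  tot := L.tot
  proj := L.proj ≫ y.hom
  act := L.act
  act_comp := L.act_comp
  act_one := L.act_one
  act_mul := L.act_mul
  act_proj v s := by rw [← Category.assoc, L.act_proj, Category.assoc]
  flat := by have := L.flat; infer_instance
  surjective := by have := L.surjective; infer_instance
  locallyOfFinitePresentation := by have := L.locallyOfFinitePresentation; infer_instance
  torsor v w h := L.torsor v w (by simpa [← Category.assoc] using h)

theorem LineBundle.lineComm_push {Y' Y : Scheme.{u}} (L : LineBundle Y') (y : Y' ≅ Y) :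
    LineComm y L (L.push y) (Iso.refl _) where
  proj := Category.id_comp _
  act v s := (Category.comp_id _).trans congr(L.act $((Category.comp_id v).symm) s)

theorem isIso_pullback_fst {X Y S : Scheme.{u}} (f : X ⟶ S) (g : Y ⟶ S) [IsIso g] :
    IsIso (pullback.fst f g) :=
  MorphismProperty.of_isPullback (P := MorphismProperty.isomorphisms Scheme)
    (IsPullback.of_hasPullback f g).flip ‹IsIso g›

theorem LineBundle.exists_lineComm_pullback {Y' Y : Scheme.{u}} (L : LineBundle Y) (y : Y' ≅ Y)
    {h : Y' ⟶ Y} (e : y.hom = h) :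
    ∃ l : (L.pullback h).tot ≅ L.tot, LineComm y (L.pullback h) L l := by
  subst e
  exact ⟨@asIso _ _ _ _ (pullback.fst L.proj y.hom) (isIso_pullback_fst _ _),
    pullback.condition, fun _ _ => pullback.lift_fst _ _ _⟩

/-- The dimension of a span is invariant under a ring isomorphism which is semilinear with respect
to an automorphism `σ` of the field of scalars. -/
theorem finrank_span_eq_of_semilinear {k : Type*} {R R' : Type u} [Field k] [CommRing R]
    [CommRing R']
    (c : k →+* R) (c' : k →+* R') (e : R ≃+* R') (σ : k ≃+* k) (h : ∀ a, e (c a) = c' (σ a))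
    (A : Set R) (A' : Set R') (hA : ∀ x, e x ∈ A' ↔ x ∈ A) :
    letI := Module.compHom R c
    letI := Module.compHom R' c'
    Module.finrank k (Submodule.span k A) = Module.finrank k (Submodule.span k A') := by
  let _ := Module.compHom R c
  let _ := Module.compHom R' c'
  have := RingHomInvPair.of_ringEquiv σ
  have := RingHomInvPair.of_ringEquiv σ.symm
  let E : R ≃ₛₗ[(σ : k →+* k)] R' :=
    { e with
      map_smul' := fun a x => (map_mul e (c a) x).trans (congrArg (· * e x) (h a)) }
  have h₁ : (Submodule.span k A).map E.toLinearMap = Submodule.span k A' := by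
    rw [Submodule.map_span]
    congr 1
    ext x
    obtain ⟨x, rfl⟩ := e.surjective x
    rw [hA]
    exact e.injective.mem_set_image
  rw [← h₁]
  let F := E.submoduleMap (Submodule.span k A)
  refine congrArg Cardinal.toNat ?_
  have h₂ := lift_rank_eq_of_equiv_equiv (σ : k → k) F.toAddEquiv σ.bijective
    (fun a x => F.map_smulₛₗ a x)
  simpa using h₂

section

variable {k : Type u} [Field k] {σ : k ≃+* k} {Z' Z : Over (Spec (.of k))}
  {z : OverIso (specIso σ) Z' Z} {L' H' : LineBundle Z'.left} {L H : LineBundle Z.left}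
  {l : L'.tot ≅ L.tot} {h : H'.tot ≅ H.tot}

/-- Composing the structure map with an automorphism of `Spec k` twists the scalars. -/
theorem scalars_comp_specIso {X : Scheme.{u}} (f : X ⟶ Spec (.of k)) (a : k) :
    scalars (f ≫ (specIso σ).hom) a = scalars f (σ a) := by
  have h₁ := congr($(Scheme.ΓSpecIso_inv_naturality (CommRingCat.ofHom (σ : k →+* k))) a)
  simp only [scalars, Scheme.Hom.comp_appTop, CommRingCat.hom_comp, RingHom.comp_apply] at h₁ ⊢
  exact congrArg _ h₁.symm

theorem scalars_comp {X Y : Scheme.{u}} (f : X ⟶ Y) (g : Y ⟶ Spec (.of k)) (a : k) :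
    scalars (f ≫ g) a = f.appTop (scalars g a) := by
  simp only [scalars, Scheme.Hom.comp_appTop]
  rfl

theorem h0_eq (hL : LineComm z.iso L' L l) (hH : LineComm z.iso H' H h) (a n : ℤ) :
    h0 L' H' a n = h0 L H a n := by
  let w := pullbackMapIso l h z.iso hL.proj.symm hH.proj.symm
  have hw : w.hom ≫ pullback.fst L.proj H.proj ≫ L.proj ≫ Z.hom =
      (pullback.fst L'.proj H'.proj ≫ L'.proj ≫ Z'.hom) ≫ (specIso σ).hom := by
    rw [← Category.assoc, pullbackMapIso_hom_fst, Category.assoc, reassoc_of% hL.proj,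
      z.w, Category.assoc, Category.assoc]
  have hact {T : Scheme.{u}} (v : T ⟶ Limits.pullback L'.proj H'.proj) (s t : Γ(T, ⊤)ˣ) :
      L'.act₂ H' v s t ≫ w.hom = L.act₂ H (v ≫ w.hom) s t := by
    apply pullback.hom_ext
    · rw [Category.assoc, pullbackMapIso_hom_fst, LineBundle.act₂, LineBundle.act₂,
        pullback.lift_fst, pullback.lift_fst_assoc, hL.act, Category.assoc, Category.assoc,
        pullbackMapIso_hom_fst]
    · rw [Category.assoc, pullbackMapIso_hom_snd, LineBundle.act₂, LineBundle.act₂,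
        pullback.lift_snd, pullback.lift_snd_assoc, hH.act, Category.assoc, Category.assoc,
        pullbackMapIso_hom_snd]
  have happ {T : Scheme.{u}} (v : T ⟶ Limits.pullback L'.proj H'.proj)
      (x : Γ(Limits.pullback L.proj H.proj, ⊤)) :
      v.appTop.hom (globalEquiv w x) = (v ≫ w.hom).appTop.hom x :=
    congr($(Scheme.Hom.comp_appTop v w.hom) x).symm
  symm
  refine finrank_span_eq_of_semilinear _ _ (globalEquiv w) σ (fun a => ?_) _ _ fun x => ?_
  · rw [← scalars_comp_specIso, ← hw, scalars_comp w.hom]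
    rfl
  · constructor
    · intro hx T v s t
      have h₁ := hx T (v ≫ w.inv) s t
      rw [happ, happ, hact, Category.assoc, Iso.inv_hom_id, Category.comp_id] at h₁
      exact h₁
    · intro hx T v s t
      rw [happ, happ, hact]
      exact hx T (v ≫ w.hom) s t

theorem degree_eq (hL : LineComm z.iso L' L l) (hH : LineComm z.iso H' H h) :
    degree H' L' = degree H L := by
  have h₁ : topologicalKrullDim Z'.left = topologicalKrullDim Z.left :=
    IsHomeomorph.topologicalKrullDim_eq _ z.iso.hom.homeomorph.isHomeomorph
  simp only [degree, h₁, h0_eq hL hH]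

end

/-! ### Base change of isomorphisms -/

namespace OverIso

section BaseChange

variable {B' B C' C : Scheme.{u}} {b : B' ≅ B} {a : C' ≅ C} {c' : C' ⟶ B'} {c : C ⟶ B}
  (w : a.hom ≫ c = c' ≫ b.hom) {X' Y' : Over B'} {X Y : Over B} (x : OverIso b X' X)
  (y : OverIso b Y' Y)

/-- Base change of an isomorphism along compatible changes of bases. -/
def baseChange : OverIso a ((Over.pullback c').obj X') ((Over.pullback c).obj X) where
  iso := pullbackMapIso x.iso a b x.w.symm w.symm
  w := pullbackMapIso_hom_snd _ _ _ _ _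

theorem baseChange_fst : (x.baseChange w).iso.hom ≫ pullback.fst X.hom c =
    pullback.fst X'.hom c' ≫ x.iso.hom :=
  pullback.lift_fst _ _ _

theorem overPullback_map_fst (f : X ⟶ Y) :
    ((Over.pullback c).map f).left ≫ pullback.fst Y.hom c = pullback.fst X.hom c ≫ f.left :=
  pullback.lift_fst _ _ _

variable {x y}

theorem Comm.baseChange {f' : X' ⟶ Y'} {f : X ⟶ Y} (h : Comm x y f' f) :
    Comm (x.baseChange w) (y.baseChange w) ((Over.pullback c').map f')
      ((Over.pullback c).map f) := by
  have h₁ : x.iso.hom ≫ f.left = f'.left ≫ y.iso.hom := h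
  have h₂ := baseChange_fst w x
  have h₃ := baseChange_fst w y
  have h₄ := overPullback_map_fst (c := c) f
  have h₅ := overPullback_map_fst (c := c') f'
  have h₆ : (x.baseChange w).iso.hom ≫ ((Over.pullback c).map f).left ≫ pullback.snd Y.hom c =
      pullback.snd X'.hom c' ≫ a.hom :=
    (congrArg _ (Over.w ((Over.pullback c).map f))).trans (x.baseChange w).w
  have h₇ : ((Over.pullback c').map f').left ≫ (y.baseChange w).iso.hom ≫ pullback.snd Y.hom c =
      pullback.snd X'.hom c' ≫ a.hom :=
    (congrArg _ (y.baseChange w).w).trans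
      (Over.w_assoc ((Over.pullback c').map f') a.hom)
  apply pullback.hom_ext
  · rw [Category.assoc, h₄, reassoc_of% h₂, h₁, Category.assoc, h₃, reassoc_of% h₅]
  · rw [Category.assoc, h₆, Category.assoc, h₇]

/-- The comparison isomorphisms of base change functors with products correspond to each other. -/
theorem comm_mu : Comm ((x.baseChange w).tensor (y.baseChange w)) ((x.tensor y).baseChange w)
    (Functor.LaxMonoidal.μ (Over.pullback c') X' Y')
    (Functor.LaxMonoidal.μ (Over.pullback c) X Y) := by
  have key : tr ((x.baseChange w).tensor (y.baseChange w)) ((x.tensor y).baseChange w)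
      (Functor.LaxMonoidal.μ (Over.pullback c') X' Y') =
      Functor.LaxMonoidal.μ (Over.pullback c) X Y := by
    rw [← cancel_mono (Functor.OplaxMonoidal.δ (Over.pullback c) X Y), Functor.Monoidal.μ_δ]
    apply CartesianMonoidalCategory.hom_ext
    · rw [Category.assoc, Functor.OplaxMonoidal.δ_fst, Category.id_comp]
      exact ((comm_tr _).comp (comm_fst.baseChange w)).unique
        (by rw [Functor.Monoidal.μ_fst]; exact comm_fst)
    · rw [Category.assoc, Functor.OplaxMonoidal.δ_snd, Category.id_comp]
      exact ((comm_tr _).comp (comm_snd.baseChange w)).unique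
        (by rw [Functor.Monoidal.μ_snd]; exact comm_snd)
  exact key ▸ comm_tr _

theorem IsMul.baseChange [GrpObj X'] [GrpObj X] (h : x.IsMul) : (x.baseChange w).IsMul := by
  rw [IsMul, Functor.obj.μ_def, Functor.obj.μ_def]
  exact (comm_mu w).comp (Comm.baseChange w h)

end BaseChange

section Precomp

variable {B' B : Scheme.{u}} {b : B' ≅ B} {X₁ X' : Over B'} {X : Over B}

/-- Precomposition with an isomorphism over `B'`. -/
def precomp (e : X₁ ≅ X') (x : OverIso b X' X) : OverIso b X₁ X where
  iso :=
    { hom := e.hom.left ≫ x.iso.hom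
      inv := x.iso.inv ≫ e.inv.left }
  w := by
    rw [Category.assoc, x.w]
    exact Over.w_assoc e.hom b.hom

theorem comm_precomp (e : X₁ ≅ X') (x : OverIso b X' X) : Comm (x.precomp e) x e.hom (𝟙 X) :=
  Category.comp_id _

theorem IsMul.precomp [GrpObj X₁] [GrpObj X'] [GrpObj X] {x : OverIso b X' X} (h : x.IsMul)
    (e : X₁ ≅ X') [IsMonHom e.hom] : (x.precomp e).IsMul := by
  have h₁ := comm_precomp e x
  have h₃ : tr ((x.precomp e).tensor (x.precomp e)) (x.precomp e) μ[X₁] = μ[X] := by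
    rw [← Category.comp_id (tr _ _ _)]
    refine ((comm_tr _).comp h₁).unique ?_
    rw [IsMonHom.mul_hom, ← Category.id_comp μ[X], ← id_tensorHom_id]
    exact (h₁.tensorHom h₁).comp h
  rw [IsMul, ← h₃]
  exact comm_tr _

end Precomp

section OfPullback

variable {B' B : Scheme.{u}} (b : B' ≅ B) {β : B' ⟶ B} (hβ : b.hom = β) {X Y : Over B}

/-- The projection of the base change along an isomorphism. -/
def ofPullback (X : Over B) : OverIso b ((Over.pullback β).obj X) X where
  iso := @asIso _ _ _ _ (pullback.fst X.hom β)
    (have : IsIso β := hβ ▸ inferInstance; isIso_pullback_fst _ _)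
  w := hβ ▸ pullback.condition

theorem comm_ofPullback (f : X ⟶ Y) :
    Comm (ofPullback b hβ X) (ofPullback b hβ Y) ((Over.pullback β).map f) f :=
  (pullback.lift_fst _ _ _).symm

/-- Up to the projections, the comparison isomorphism of the base change functor with products is
the identity. -/
theorem comm_ofPullback_mu :
    Comm ((ofPullback b hβ X).tensor (ofPullback b hβ Y)) (ofPullback b hβ (X ⊗ Y))
      (Functor.LaxMonoidal.μ (Over.pullback β) X Y) (𝟙 (X ⊗ Y)) := by
  have key : tr ((ofPullback b hβ X).tensor (ofPullback b hβ Y)) (ofPullback b hβ (X ⊗ Y))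
      (Functor.LaxMonoidal.μ (Over.pullback β) X Y) = 𝟙 (X ⊗ Y) := by
    apply CartesianMonoidalCategory.hom_ext
    · rw [Category.id_comp]
      exact ((comm_tr _).comp (comm_ofPullback b hβ _)).unique
        (by rw [Functor.Monoidal.μ_fst]; exact comm_fst)
    · rw [Category.id_comp]
      exact ((comm_tr _).comp (comm_ofPullback b hβ _)).unique
        (by rw [Functor.Monoidal.μ_snd]; exact comm_snd)
  exact key ▸ comm_tr _

theorem isMul_ofPullback [GrpObj X] : (ofPullback b hβ X).IsMul := by
  rw [IsMul, Functor.obj.μ_def, ← Category.id_comp μ[X]]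
  exact (comm_ofPullback_mu b hβ).comp (comm_ofPullback b hβ _)

end OfPullback

end OverIso

/-! ### Tori, roots, parabolic subgroups and characters -/

section Groups

variable {k : Type u} [Field k] {b : Spec (.of k) ≅ Spec (.of k)}
  {G' G T' T P' P : Over (Spec (.of k))} [GrpObj G'] [GrpObj G] [GrpObj T'] [GrpObj T] [GrpObj P']
  [GrpObj P] {g : OverIso b G' G} {t : OverIso b T' T} {q : OverIso b P' P}

/-- The twist of a morphism: the underlying morphism of schemes is unchanged. -/
def twistMap (b : Spec (.of k) ≅ Spec (.of k)) {S' R' : Over (Spec (.of k))} (h : R' ⟶ S') :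
    twist b R' ⟶ twist b S' :=
  Over.homMk h.left

theorem comm_twistMap {S' R' : Over (Spec (.of k))} (h : R' ⟶ S') :
    Comm (toTwist b R') (toTwist b S') h (twistMap b h) :=
  (Category.id_comp _).trans (Category.comp_id _).symm

theorem IsSplitTorus.of_isMul (ht : t.IsMul) (H : IsSplitTorus T) : IsSplitTorus T' := by
  obtain ⟨r, e, he⟩ := H
  refine ⟨r, fun S' => (trMul (toTwist b S') ht).trans (e (twist b S')), fun S' R' h x i => ?_⟩
  have h₁ : trMul (toTwist b R') ht (h ≫ x) = twistMap b h ≫ trMul (toTwist b S') ht x :=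
    ((comm_twistMap h).comp (comm_tr x)).tr_eq
  exact (congr(e (twist b R') $h₁ i)).trans (he _ _ _ _ i)

/-- Maximality is tested over the algebraic closure, so an automorphism of `k` has to be extended to
it. -/
theorem IsSplitMaximalTorus.of_comm (σ : ClosureAut k) {g : OverIso σ.spec G' G}
    {t : OverIso σ.spec T' T} (hg : g.IsMul) (ht : t.IsMul) {i' : T' ⟶ G'} {i : T ⟶ G}
    (hi : Comm t g i' i) (H : IsSplitMaximalTorus i) : IsSplitMaximalTorus i' := by
  obtain ⟨h₁, h₂, h₃, h₄⟩ := H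
  refine ⟨isMonHom ht.symm hg.symm hi.symm h₁, hi.symm.property (P := @IsClosedImmersion) h₂,
    h₃.of_isMul ht, fun T₀' _ i₀' j' hm hc hs hw => ?_⟩
  have w := σ.geomPoint.w
  let a := specIso σ.aut
  let t₀ := toTwist a T₀'
  let _ := twistGrpObj a T₀'
  have ht₀ : t₀.IsMul := toTwist_isMul
  have hj : Comm (t.baseChange w) t₀ j' (tr _ _ j') := comm_tr _
  have hi₀ : Comm t₀ (g.baseChange w) i₀' (tr _ _ i₀') := comm_tr _
  have := h₄ (twist a T₀') inferInstance (tr t₀ (g.baseChange w) i₀') (tr (t.baseChange w) t₀ j')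
    (isMonHom ht₀ (hg.baseChange w) hi₀ hm) (hi₀.property (P := @IsClosedImmersion) hc)
    (hs.of_isMul ht₀.symm) ((hj.comp hi₀).unique (hw ▸ hi.baseChange w))
  exact hj.symm.isIso

/-- Transport of homomorphisms from `SL₂`. -/
def SL2Hom.pull (hg : g.IsMul) (φ : SL2Hom G) : SL2Hom G' where
  app S' := (trMul (toTwist b S') hg).symm.toMonoidHom.comp (φ.app (twist b S'))
  naturality S' R' h A :=
    ((comm_twistMap h).comp (comm_tr_symm (φ.app (twist b S') A))).unique'
      ((φ.naturality (twist b S') (twist b R') (twistMap b h) A) ▸ comm_tr_symm _)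

theorem SL2Hom.comm_pull (hg : g.IsMul) (φ : SL2Hom G) (S' : Over (Spec (.of k)))
    (A : Matrix.SpecialLinearGroup (Fin 2) Γ(S'.left, ⊤)) :
    Comm (toTwist b S') g ((φ.pull hg).app S' A) (φ.app (twist b S') A) :=
  comm_tr_symm _

/-- Transport of characters. -/
def Character.pull (ht : t.IsMul) (α : Character T) : Character T' where
  unit := unitsMap t.iso.hom α.unit
  map_mul S' x y := by
    have key (z : S' ⟶ T') : unitsMap z.left (unitsMap t.iso.hom α.unit) =
        unitsMap (tr (toTwist b S') t z).left α.unit := by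
      rw [← unitsMap_comp]
      have h : z.left ≫ t.iso.hom = (tr (toTwist b S') t z).left :=
        (comm_tr z).toTwist_left.symm
      rw [h]
    have h := α.map_mul (twist b S') (tr (toTwist b S') t x) (tr (toTwist b S') t y)
    have h₁ : tr (toTwist b S') t (x * y) = tr (toTwist b S') t x * tr (toTwist b S') t y :=
      (ht.mul (comm_tr x) (comm_tr y)).tr_eq
    rw [← h₁] at h
    exact (key _).trans (h.trans (congrArg₂ (· * ·) (key _).symm (key _).symm))

/-- The characters `χ'` and `χ` correspond to each other under `q`. -/
def CharComm (q : OverIso b P' P) (χ' : Character P') (χ : Character P) : Prop :=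
  χ'.unit = unitsMap q.iso.hom χ.unit

theorem CharComm.symm {χ' : Character P'} {χ : Character P} (h : CharComm q χ' χ) :
    CharComm q.symm χ χ' := by
  rw [CharComm, h, ← unitsMap_comp]
  exact ((congr(unitsMap $(q.iso.inv_hom_id) χ.unit)).trans (unitsMap_id _)).symm

theorem CharComm.eval {χ' : Character P'} {χ : Character P} (h : CharComm q χ' χ)
    {S' S : Over (Spec (.of k))} {s : OverIso b S' S} {x' : S' ⟶ P'} {x : S ⟶ P}
    (hx : Comm s q x' x) : χ'.eval x' = unitsMap s.iso.hom (χ.eval x) := by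
  change unitsMap x'.left χ'.unit = unitsMap s.iso.hom (unitsMap x.left χ.unit)
  rw [h, ← unitsMap_comp, ← unitsMap_comp, hx]

theorem CharComm.eval_toTwist {χ' : Character P'} {χ : Character P} (h : CharComm q χ' χ)
    {S' : Over (Spec (.of k))} {x' : S' ⟶ P'} {x : twist b S' ⟶ P}
    (hx : Comm (toTwist b S') q x' x) : χ'.eval x' = χ.eval x :=
  (h.eval hx).trans (unitsMap_id _)

theorem CharComm.eval_ofTwist {χ' : Character P'} {χ : Character P} (h : CharComm q χ' χ)
    {S : Over (Spec (.of k))} {x' : twist b.symm S ⟶ P'} {x : S ⟶ P}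
    (hx : Comm (ofTwist b S) q x' x) : χ'.eval x' = χ.eval x :=
  (h.eval hx).trans (unitsMap_id _)

theorem IsRootHom.of_comm (hg : g.IsMul) (ht : t.IsMul) {i' : T' ⟶ G'} {i : T ⟶ G}
    (hi : Comm t g i' i) {α : Character T} {φ : SL2Hom G} (H : IsRootHom i α φ) :
    IsRootHom i' (α.pull ht) (φ.pull hg) where
  upper_injective S' := (trMul (toTwist b S') hg).symm.injective.comp
    (H.upper_injective (twist b S'))
  lower_injective S' := (trMul (toTwist b S') hg).symm.injective.comp
    (H.lower_injective (twist b S'))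
  conj_upper S' x a := by
    have hx : Comm (toTwist b S') g (x ≫ i') (tr (toTwist b S') t x ≫ i) := (comm_tr x).comp hi
    have h := H.conj_upper (twist b S') (tr (toTwist b S') t x) a
    rw [CharComm.eval_toTwist (χ := α) (χ' := α.pull ht) (q := t) rfl (comm_tr x)]
    exact (hg.mul (hg.mul hx (φ.comm_pull hg S' (upper a))) (hg.inv hx)).unique'
      (h ▸ φ.comm_pull hg S' _)
  conj_lower S' x a := by
    have hx : Comm (toTwist b S') g (x ≫ i') (tr (toTwist b S') t x ≫ i) := (comm_tr x).comp hi
    have h := H.conj_lower (twist b S') (tr (toTwist b S') t x) a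
    rw [CharComm.eval_toTwist (χ := α) (χ' := α.pull ht) (q := t) rfl (comm_tr x)]
    exact (hg.mul (hg.mul hx (φ.comm_pull hg S' (lower a))) (hg.inv hx)).unique'
      (h ▸ φ.comm_pull hg S' _)
  diag_mem S' s := by
    obtain ⟨x, hx⟩ := H.diag_mem (twist b S') s
    exact ⟨(tr (toTwist b S') t).symm x,
      ((comm_tr_symm x).comp hi).unique' (hx ▸ φ.comm_pull hg S' _)⟩

/-- The tori and roots by which `χ` is tested are moved in the direction opposite to that in which
antidominance is transported. -/
theorem Character.IsAntidominant.of_comm (σ : ClosureAut k) {g : OverIso σ.spec G' G}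
    {q : OverIso σ.spec P' P} (hg : g.IsMul) (hq : q.IsMul) {i' : P' ⟶ G'} {i : P ⟶ G}
    (hi : Comm q g i' i) {χ' : Character P'} {χ : Character P} (hχ : CharComm q χ' χ)
    (H : χ'.IsAntidominant i') : χ.IsAntidominant i := by
  intro T _ j α φ hj hmax hroot hup n hn
  let t : OverIso σ.spec (twist σ.spec.symm T) T := (toTwist σ.spec.symm T).symm
  let _ := twistGrpObj σ.spec.symm T
  have ht : t.IsMul := IsMul.symm (g := toTwist σ.spec.symm T) toTwist_isMul
  have hj' : Comm t q ((tr t q).symm j) j := comm_tr_symm j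
  refine H (twist σ.spec.symm T) inferInstance ((tr t q).symm j) (α.pull ht) (φ.pull hg)
    (isMonHom ht.symm hq.symm hj'.symm hj) (hmax.of_comm σ hg ht (hj'.comp hi))
    (hroot.of_comm hg ht (hj'.comp hi)) (fun S' a => ?_) n fun S' s y' hy' => ?_
  · obtain ⟨y, hy⟩ := hup (twist σ.spec S') a
    exact ⟨(tr (toTwist σ.spec S') q).symm y,
      ((comm_tr_symm y).comp hi).unique' (hy ▸ φ.comm_pull hg S' _)⟩
  · have hy := comm_tr (x := toTwist σ.spec S') (y := q) y'
    have h₁ : tr (toTwist σ.spec S') q y' ≫ i = φ.app (twist σ.spec S') (diag s) :=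
      (hy.comp hi).unique (hy' ▸ φ.comm_pull hg S' (diag s))
    rw [hχ.eval_toTwist hy]
    exact hn (twist σ.spec S') s _ h₁

theorem Character.IsTrivialOnCenter.of_comm (hq : q.IsMul) {χ' : Character P'} {χ : Character P}
    (hχ : CharComm q χ' χ) (H : χ'.IsTrivialOnCenter) : χ.IsTrivialOnCenter := by
  intro S z hz
  have hz' : Comm (ofTwist b S) q ((tr (ofTwist b S) q).symm z) z := comm_tr_symm z
  have hc (R' : Over (Spec (.of k))) (h' : R' ⟶ twist b.symm S) (x' : R' ⟶ P') :
      (h' ≫ (tr (ofTwist b S) q).symm z) * x' = x' * (h' ≫ (tr (ofTwist b S) q).symm z) := by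
    have hh := (comm_tr (x := toTwist b R') (y := ofTwist b S) h').comp hz'
    have hx := comm_tr (x := toTwist b R') (y := q) x'
    have h₁ := hz _ (tr (toTwist b R') (ofTwist b S) h') (tr (toTwist b R') q x')
    refine (hq.mul hh hx).unique' ?_
    rw [h₁]
    exact hq.mul hx hh
  have h₂ := H _ _ hc
  rwa [hχ.eval_ofTwist hz'] at h₂

theorem IsParabolic.of_comm (hg : g.IsMul) (hq : q.IsMul) {i' : P' ⟶ G'} {i : P ⟶ G}
    (hi : Comm q g i' i) (H : IsParabolic i') : IsParabolic i := by
  obtain ⟨h₁, h₂, h₃, Q', r', h₄, h₅, h₆, h₇, h₈⟩ := H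
  have hr : Comm g (toTwist b Q') r' (tr _ _ r') := comm_tr r'
  exact ⟨isMonHom hq hg hi h₁, hi.property (P := @IsClosedImmersion) h₂,
    q.property_hom (P := @Smooth) h₃, twist b Q', tr _ _ r',
    (toTwist b Q').property_hom (P := @IsProper) h₄, hr.property (P := @Flat) h₅,
    hr.property (P := @Surjective) h₆, hr.property (P := @LocallyOfFinitePresentation) h₇,
    isPullback comm_fst (hi.whiskerLeft.comp hg) hr hr h₈⟩

end Groups

/-! ### Stability -/

/-- Stability with respect to `H` is transported to `Z'`: whatever tests stability on `Z'` is moved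
to `Z`. -/
theorem IsRStable.of_corr {k : Type u} [Field k] (σ : ClosureAut k) {G' G : Over (Spec (.of k))}
    [GrpObj G'] [GrpObj G] {g : OverIso σ.spec G' G} (hg : g.IsMul) {Z' Z : Over (Spec (.of k))}
    {z : OverIso σ.spec Z' Z} {H' : LineBundle Z'.left} {H : LineBundle Z.left}
    {l : H'.tot ≅ H.tot} (hH : LineComm z.iso H' H l) {c : ℤ} {E' : GBundle G' Z'} {E : GBundle G Z}
    {D' : LambdaConnection c E' Z'.hom} {D : LambdaConnection c E Z.hom} (hD : Corr g z D' D)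
    (hS : IsRStable H D) : IsRStable H' D' := by
  intro P' _ i' hpar hprop Q' j' hred ⟨DQ', hDQ⟩ χ' hne hanti hcent L' ⟨r', hr, hr'⟩
  obtain ⟨m, hm, hmD⟩ := hD
  have hbase : BaseCompat z.iso Z'.hom Z.hom := ⟨σ.spec, z.w⟩
  -- The subgroup, the reduction, the character and the line bundle are moved from `Z'` to `Z`.
  let q := toTwist σ.spec P'
  let _ := twistGrpObj σ.spec P'
  have hq : q.IsMul := toTwist_isMul
  have hi : Comm q g i' (tr q g i') := comm_tr i'
  let Q := pullGBundle hq.symm z.symm Q'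
  let n₀ : OverIso σ.spec.symm Q.tot Q'.tot := ofTwist σ.spec.symm Q'.tot
  have hn₀ : BundleComm q.symm z.symm Q Q' n₀ := bundleComm_pullGBundle hq.symm z.symm Q'
  let n : OverIso σ.spec Q'.tot Q.tot := n₀.symm
  have hn : BundleComm q z Q' Q n := hn₀.symm
  have hj : Comm n m j' (tr n m j') := comm_tr j'
  obtain ⟨DQ, hDQ'⟩ := hn₀.exists_pullsBackAlong hbase.symm DQ'
  let χ : Character (twist σ.spec P') := χ'.pull hq.symm
  have hχ : CharComm q χ' χ := CharComm.symm (q := q.symm) rfl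
  rw [degree_eq (L'.lineComm_push z.iso) hH]
  refine hS (twist σ.spec P') inferInstance (tr q g i') (hpar.of_comm hg hq hi)
    (fun _ => hprop hi.symm.isIso) Q (tr n m j') ⟨?_, ?_⟩ ⟨DQ, fun U u => ?_⟩ χ (fun h => hne ?_)
    (hanti.of_comm σ hg hq hi hχ) (hcent.of_comm hq hχ) (L'.push z.iso)
    ⟨n.iso.inv ≫ r', ?_, fun S v x => ?_⟩
  · exact (hj.comp hm.proj).unique (hred.1 ▸ hn.proj)
  · exact (hn.act.comp hj).unique (hred.2 ▸ (hj.tensorHom hi).comp hm.act)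
  -- The connection on the reduction induces that on the bundle.
  · have e : z.iso.hom ⁻¹ᵁ U ≤ z.iso.hom ⁻¹ᵁ U := le_rfl
    have e' : U ≤ z.iso.inv ⁻¹ᵁ z.iso.hom ⁻¹ᵁ U := le_inv_preimage z.iso.symm U
    obtain ⟨u', hu⟩ := hbase.exists_related u e
    have hu' : Related z.iso.inv u u' := hu.symm e
    refine Related.conj (y' := n₀.iso) (y := m.iso.symm) hj.symm (hn₀.preimage_le e')
      (hm.symm.preimage_le e') ?_ ?_ (hDQ _ u')
    · exact hDQ'.related hn₀ e' hu'
    · exact PullsBackAlong.related hm.symm (hmD.symm hm) e' hu'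
  · rw [hχ, h, map_one]
  · have h₁ : n.iso.inv ≫ Q'.proj.left = Q.proj.left ≫ z.iso.inv := hn₀.proj
    change (n.iso.inv ≫ r') ≫ L'.proj ≫ z.iso.hom = _
    rw [Category.assoc, reassoc_of% hr, reassoc_of% h₁, Iso.inv_hom_id, Category.comp_id]
  · have hv := comm_tr_symm (x := ofTwist σ.spec S) (y := n) v
    have hx := comm_tr_symm (x := ofTwist σ.spec S) (y := q) x
    have h₁ := hr' _ ((tr (ofTwist σ.spec S) n).symm v) ((tr (ofTwist σ.spec S) q).symm x)
    have h₂ := ((hv.lift hx).comp hn.act).ofTwist_left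
    have h₃ := hv.ofTwist_left
    have h₄ {R : Scheme.{u}} (w : R ⟶ Q'.tot.left) : (w ≫ n.iso.hom) ≫ n.iso.inv ≫ r' = w ≫ r' := by
      rw [Category.assoc, Iso.hom_inv_id_assoc]
    rw [h₂, h₃, ← hχ.eval_ofTwist hx]
    exact (h₄ _).trans (h₁.trans congr(L'.act $((h₄ _).symm) _))

/-! ### Frobenius pullback -/

section Frobenius

variable {k : Type u} [Field k] [PerfectField k] (p : ℕ) [Fact p.Prime] [CharP k p]

/-- The Frobenius automorphism. An intermediate field is perfect, being algebraic over `k`, and is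
therefore preserved by the inverse of Frobenius, too. -/
def frobAut (k : Type u) [Field k] [PerfectField k] (p : ℕ) [Fact p.Prime] [CharP k p] :
    ClosureAut k :=
  have := charP_of_injective_algebraMap (algebraMap k (AlgebraicClosure k)).injective p
  have := PerfectField.toPerfectRing (K := k) p
  have := PerfectField.toPerfectRing (K := AlgebraicClosure k) p
  { base := frobeniusEquiv k p
    aut := frobeniusEquiv (AlgebraicClosure k) p
    aut_algebraMap := fun x => by simp [frobenius_def]
    mem_iff := fun K x => by
      have := charP_of_injective_algebraMap (algebraMap k K).injective p
      have := Algebra.IsAlgebraic.perfectField (K := k) (L := K)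
      have := PerfectField.toPerfectRing (K := K) p
      refine ⟨fun h => ?_, fun h => by simpa [frobenius_def] using pow_mem h p⟩
      obtain ⟨y, hy⟩ := (frobeniusEquiv K p).surjective ⟨_, h⟩
      have : (y : AlgebraicClosure k) = x := by
        apply (frobeniusEquiv (AlgebraicClosure k) p).injective
        simpa [frobenius_def] using congrArg Subtype.val hy
      exact this ▸ y.2 }

theorem frobAut_spec_hom : (frobAut k p).spec.hom = frobSpec k p := rfl

variable {p} {G Z : Over (Spec (.of k))} [GrpObj G] (φ : frobTwist p G ≅ G) [IsMonHom φ.hom]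

/-- The isomorphism of `G` with itself which covers the Frobenius of `Spec k` and is given by
`φ`. -/
def frobGroup : OverIso (frobAut k p).spec G G :=
  (ofPullback (frobAut k p).spec (frobAut_spec_hom p) G).precomp φ.symm

theorem frobGroup_isMul : (frobGroup φ).IsMul :=
  have : IsMonHom φ.symm.hom := inferInstanceAs (IsMonHom φ.inv)
  (isMul_ofPullback _ _).precomp φ.symm

theorem bundleComm_frobPullback (E : GBundle G Z) :
    BundleComm (frobGroup φ) (ofPullback (frobAut k p).spec (frobAut_spec_hom p) Z)
      (E.frobPullback p φ) E (ofPullback (frobAut k p).spec (frobAut_spec_hom p) E.tot) where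
  proj := comm_ofPullback _ _ _
  act := by
    have h₁ := comm_precomp φ.symm (ofPullback (frobAut k p).spec (frobAut_spec_hom p) G)
    have h₂ := (h₁.whiskerLeft (x := ofPullback (frobAut k p).spec (frobAut_spec_hom p) E.tot)).comp
      ((comm_ofPullback_mu (frobAut k p).spec (frobAut_spec_hom p)).comp
        (comm_ofPullback _ _ E.act))
    rw [MonoidalCategory.whiskerLeft_id, Category.id_comp, Category.id_comp] at h₂
    exact h₂

/-- The pullback of a stable `c`-connection along the projection of the Frobenius twist. -/
theorem exists_frobPullback {H : LineBundle Z.left} {E : GBundle G Z} {c : ℤ}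
    (D : LambdaConnection c E Z.hom) (hS : IsRStable H D) :
    ∃ D' : LambdaConnection c (E.frobPullback p φ) (frobTwist p Z).hom,
      (∀ D'', IsFrobPullback p D'' D ↔ D'' = D') ∧
      IsRStable (H.pullback (frobProj p Z)) D' ∧ (IsRigid D ↔ IsRigid D') := by
  let z := ofPullback (frobAut k p).spec (frobAut_spec_hom p) Z
  have hm := bundleComm_frobPullback φ E
  have hf : BaseCompat z.iso (frobTwist p Z).hom Z.hom := ⟨(frobAut k p).spec, z.w⟩
  obtain ⟨D', hD⟩ := hm.exists_pullsBackAlong hf D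
  have hDD : Corr (frobGroup φ) z D' D := ⟨_, hm, hD⟩
  obtain ⟨l, hl⟩ := H.exists_lineComm_pullback z.iso (h := frobProj p Z) rfl
  have hg := frobGroup_isMul φ
  exact ⟨D', fun D'' => ⟨fun h => PullsBackAlong.unique hf hm h hD, fun h => h ▸ hD⟩,
    hS.of_corr _ hg hl hDD, ((frobAut k p).isRigid_iff_of_corr hg hDD).symm⟩

end Frobenius

end HiggsRig

end

theorem mainTheorem4 {k : Type u} [Field k] [PerfectField k] (p : ℕ) [Fact p.Prime] [CharP k p]
    (G : Over (Spec (.of k))) [GrpObj G] (hG : IsConnectedSplitReductive G)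
    (φ : frobTwist p G ≅ G) [IsMonHom φ.hom]
    (Z : Over (Spec (.of k))) [IsIntegral Z.left] [Smooth Z.hom] [IsProper Z.hom]
    (H : LineBundle Z.left) (hH : H.IsAmple) (E : GBundle G Z) :
    (∀ θ : HiggsField E Z.hom, IsRStable H θ →
      ∃ θ' : HiggsField (E.frobPullback p φ) (frobTwist p Z).hom,
        (∀ θ'', IsFrobPullback p θ'' θ ↔ θ'' = θ') ∧
        IsRStable (H.pullback (frobProj p Z)) θ' ∧ (IsRigid θ ↔ IsRigid θ')) ∧
    (∀ D : IntegrableConnection E Z.hom, IsRStable H D →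
      ∃ D' : IntegrableConnection (E.frobPullback p φ) (frobTwist p Z).hom,
        (∀ D'', IsFrobPullback p D'' D ↔ D'' = D') ∧
        IsRStable (H.pullback (frobProj p Z)) D' ∧ (IsRigid D ↔ IsRigid D')) :=
  ⟨fun θ hθ => exists_frobPullback φ θ hθ, fun D hD => exists_frobPullback φ D hD⟩
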